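/- Consider a cell-free Massive MIMO downlink with $L$ access points (APs) of $M$ antennas each, $K$ single-antenna users (UEs) and $\tau_p$ mutually orthogonal pilots $\phi_1,\dots,\phi_{\tau_p}\in\mathbb C^{\tau_p}$ with $\|\phi_i\|^2=\tau_p$; put $\Phi=[\phi_1,\dots,\phi_{\tau_p}]$. UE $k$ uses pilot $i_k$ with uplink power $p_k\ge 0$, and $\mathcal P_k=\{t: i_t=i_k\}$. The channels $\mathbf h_{l,k}\sim\mathcal{CN}(0,\beta_{l,k}I_M)$ ($\beta_{l,k}\ge 0$) and the noise matrices $\mathbf N_l\in\mathbb C^{M\times\tau_p}$ with i.i.d. $\mathcal{CN}(0,1)$ entries are all independent. AP $l$ receives $\mathbf Y_l=\sum_k\sqrt{p_k}\,\mathbf h_{l,k}\phi_{i_k}^{\mathsf H}+\mathbf N_l$, puts $\bar{\mathbf H}_l=\mathbf Y_l\Phi$, and forms the MMSE channel estimates $\hat{\mathbf h}_{l,k}=c_{l,k}\mathbf Y_l\phi_{i_k}$, where $c_{l,k}=\sqrt{p_k}\beta_{l,k}/(\tau_p\sum_{t\in\mathcal P_k}p_t\beta_{l,t}+1)$. Put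 $$\gamma_{l,k}=\frac{p_k\tau_p\beta_{l,k}^2}{\tau_p\sum_{t\in\mathcal P_k}p_t\beta_{l,t}+1}.$$ Every AP $l$ has a set $\mathcal S_l\subseteq\{1,\dots,K\}$ of strong UEs, the others being weak, and UEs sharing a pilot are always in the same group. Let $\tau_{\mathcal S_l}$ be the number of different pilots used in $\mathcal S_l$, assume $\tau_{\mathcal S_l}<M$ for all $l$, let $\mathbf E_{\mathcal S_l}$ be the matrix whose columns are the standard basis vectors $\mathbf e_r\in\mathbb C^{\tau_p}$ for those pilots $r$, and let $\delta_{l,k}=1$ if $k\in\mathcal S_l$ and $\delta_{l,k}=0$ otherwise. AP $l$ uses power $\rho_{l,k}\ge0$ and precoder $\mathbf w_{l,i_k}=\mathbf v_{l,k}/\sqrt{\mathbb E\|\mathbf v_{l,k}\|^2}$ for UE $k$, where (local partial zero-forcing) $$\mathbf v_{l,k}=\bar{\mathbf H}_l\mathbf E_{\mathcal S_l}\big(\mathbf E_{\mathcal S_l}^{\mathsf H}\bar{\mathbf H}_l^{\mathsf H}\bar{\mathbf H}_l\mathbf E_{\mathcal S_l}\big)^{-1}\mathbf E_{\mathcal S_l}^{\mathsf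 H}\mathbf e_{i_k}\ \text{ if } k\in\mathcal S_l,\qquad \mathbf v_{l,k}=\bar{\mathbf H}_l\mathbf e_{i_k}\ \text{ otherwise}.$$ Then, for every UE $k$, every entry of $\hat{\mathbf h}_{l,k}$ has mean square $\gamma_{l,k}$, all $\mathbf w_{l,i_t}$ satisfy $\mathbb E\|\mathbf w_{l,i_t}\|^2=1$, all $\mathbf h_{l,k}^{\mathsf H}\mathbf w_{l,i_t}$ are square integrable, and the effective SINR of the hardening bound, $$\mathsf{SINR}_k=\frac{|\mathrm{CP}_k|^2}{\mathbb E|\mathrm{PU}_k|^2+\sum_{t\ne k}\mathbb E|\mathrm{UI}_{kt}|^2+1}=\frac{|\mathrm{CP}_k|^2}{\sum_{t=1}^K\mathbb E\big|\sum_{l}\sqrt{\rho_{l,t}}\,\mathbf h_{l,k}^{\mathsf H}\mathbf w_{l,i_t}\big|^2-|\mathrm{CP}_k|^2+1},$$ with $\mathrm{CP}_k=\sum_l\sqrt{\rho_{l,k}}\,\mathbb E\{\mathbf h_{l,k}^{\mathsf H}\mathbf w_{l,i_k}\}$, $\mathrm{PU}_k=\sum_l\sqrt{\rho_{l,k}}\,\mathbf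 h_{l,k}^{\mathsf H}\mathbf w_{l,i_k}-\mathrm{CP}_k$ and $\mathrm{UI}_{kt}=\sum_l\sqrt{\rho_{l,t}}\,\mathbf h_{l,k}^{\mathsf H}\mathbf w_{l,i_t}$, has the closed form $$\mathsf{SINR}_k=\frac{\Big(\sum_{l=1}^L\sqrt{(M-\delta_{l,k}\tau_{\mathcal S_l})\rho_{l,k}\gamma_{l,k}}\Big)^2}{\sum_{t\in\mathcal P_k\setminus\{k\}}\Big(\sum_{l=1}^L\sqrt{(M-\delta_{l,t}\tau_{\mathcal S_l})\rho_{l,t}\gamma_{l,k}}\Big)^2+\sum_{t=1}^K\sum_{l=1}^L\rho_{l,t}(\beta_{l,k}-\delta_{l,t}\delta_{l,k}\gamma_{l,k})+1}.$$ Consequently the spectral efficiency $\xi(1-\tau_p/\tau_c)\log_2(1+\mathsf{SINR}_k)$, with $0<\xi<1$ and frame length $\tau_c\ge\tau_p$, is obtained by inserting this expression. -/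

import Mathlib

noncomputable section

namespace CellFree

open MeasureTheory ProbabilityTheory Matrix
open scoped NNReal

/-- The circularly symmetric complex Gaussian law `CN(0, v)`: real and imaginary parts are
independent centred real Gaussians of variance `v / 2`. -/
def complexGaussian (v : ℝ≥0) : Measure ℂ :=
  ((gaussianReal 0 (v / 2)).prod (gaussianReal 0 (v / 2))).map (fun z : ℝ × ℝ => (⟨z.1, z.2⟩ : ℂ))

/-- The squared Euclidean norm of a complex vector. -/
def vecNormSq {M : ℕ} (v : Fin M → ℂ) : ℝ := ∑ m, ‖v m‖ ^ 2

/-- The deterministic data of a cell-free system with `L` access points (APs) of `M` antennas each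
(the number `M` enters only through the channels), `K` single-antenna users (UEs) and `τ`
pilots of length `τ`. -/
structure System (L K τ : ℕ) where
  /-- `i_k`, the index of the pilot used by UE `k` -/
  pilot : Fin K → Fin τ
  /-- the pilot book, whose `i`-th column is the pilot sequence `φ_i` -/
  Φ : Matrix (Fin τ) (Fin τ) ℂ
  /-- `p_k`, the normalized uplink power of UE `k` -/
  p : Fin K → ℝ≥0
  /-- `β_{l,k}`, the large-scale fading coefficient between AP `l` and UE `k` -/
  β : Fin L → Fin K → ℝ≥0
  /-- `ρ_{l,k}`, the normalized downlink power spent by AP `l` on UE `k` -/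
  ρ : Fin L → Fin K → ℝ≥0
  /-- `S_l`, the set of strong UEs of AP `l`; the other UEs are its weak UEs -/
  strong : Fin L → Finset (Fin K)

namespace System

variable {L K τ M : ℕ} (s : System L K τ)

/-- Mutually orthogonal pilots of squared norm `τ`. -/
def OrthogonalPilots : Prop :=
  ∀ i j : Fin τ, star (s.Φ.col i) ⬝ᵥ s.Φ.col j = if i = j then (τ : ℂ) else 0

/-- UEs that share a pilot lie in the same group (strong or weak) of every AP. -/
def CoPilotGrouping : Prop :=
  ∀ (l : Fin L) (k t : Fin K), s.pilot t = s.pilot k → k ∈ s.strong l → t ∈ s.strong l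

/-- `P_k`, the UEs (including `k`) that use the pilot of UE `k`. -/
def coPilot (k : Fin K) : Finset (Fin K) := {t | s.pilot t = s.pilot k}

/-- The set of the pilots used by the strong UEs of AP `l`. -/
def strongPilots (l : Fin L) : Finset (Fin τ) := (s.strong l).image s.pilot

/-- `τ_{S_l}`, the number of different pilots used by the strong UEs of AP `l`. -/
def tauS (l : Fin L) : ℕ := (s.strongPilots l).card

/-- `δ_{l,k}`, equal to `1` if UE `k` is strong at AP `l` and to `0` if it is weak there. -/
def δ (l : Fin L) (k : Fin K) : ℝ := if k ∈ s.strong l then 1 else 0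

/-- The coefficient `c_{l,k}` of the linear MMSE channel estimate. -/
def c (l : Fin L) (k : Fin K) : ℝ :=
  √(s.p k : ℝ) * s.β l k / (τ * ∑ t ∈ s.coPilot k, (s.p t : ℝ) * s.β l t + 1)

/-- `γ_{l,k}`, the closed form of the mean square of an entry of the channel estimate. -/
def γ (l : Fin L) (k : Fin K) : ℝ :=
  (s.p k : ℝ) * τ * (s.β l k : ℝ) ^ 2 / (τ * ∑ t ∈ s.coPilot k, (s.p t : ℝ) * s.β l t + 1)

/-- The selection matrix `E_{S_l}`: its columns are the standard basis vectors `e_r`, for `r` in the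
set of the pilots of the strong UEs of AP `l`. -/
def selection (l : Fin L) : Matrix (Fin τ) (s.strongPilots l) ℂ :=
  Matrix.of fun a r => if a = (r : Fin τ) then 1 else 0

/-- For a strong UE `k` of AP `l`, the standard basis vector of the coordinate of its pilot. -/
def basisVec (l : Fin L) (k : Fin K) : s.strongPilots l → ℂ :=
  fun r => if (r : Fin τ) = s.pilot k then 1 else 0

variable {Ω : Type*} [MeasurableSpace Ω]

/-- Independent Rayleigh fading and receiver noise: the entries of all the channel vectors
`h_{l,k} ∼ CN(0, β_{l,k} I_M)` and of all the noise matrices `N_l`, with `CN(0, 1)` entries,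
are jointly independent. -/
structure RayleighFading (P : Measure Ω) (h : Fin L → Fin K → Ω → Fin M → ℂ)
    (N : Fin L → Ω → Matrix (Fin M) (Fin τ) ℂ) : Prop where
  channel_law : ∀ l k m, HasLaw (fun ω => h l k ω m) (complexGaussian (s.β l k)) P
  noise_law : ∀ l m j, HasLaw (fun ω => N l ω m j) (complexGaussian 1) P
  indep : iIndepFun (Sum.elim
    (fun (x : Fin L × Fin K × Fin M) ω => h x.1 x.2.1 ω x.2.2)
    (fun (y : Fin L × Fin M × Fin τ) ω => N y.1 ω y.2.1 y.2.2)) P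

variable (P : Measure Ω) (h : Fin L → Fin K → Ω → Fin M → ℂ)
  (N : Fin L → Ω → Matrix (Fin M) (Fin τ) ℂ)

/-- The received pilot signal `Y_l = ∑_k √p_k h_{l,k} φ_{i_k}ᴴ + N_l`. -/
def received (l : Fin L) (ω : Ω) : Matrix (Fin M) (Fin τ) ℂ :=
  ∑ k, ((√(s.p k : ℝ) : ℝ) : ℂ) • vecMulVec (h l k ω) (star (s.Φ.col (s.pilot k))) + N l ω

/-- The matrix `Y_l Φ`, whose columns are proportional to the channel estimates. -/
def Hbar (l : Fin L) (ω : Ω) : Matrix (Fin M) (Fin τ) ℂ := s.received h N l ω * s.Φ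

/-- The MMSE channel estimate `c_{l,k} Y_l φ_{i_k}`. -/
def estimate (l : Fin L) (k : Fin K) (ω : Ω) : Fin M → ℂ :=
  (s.c l k : ℂ) • (s.received h N l ω *ᵥ s.Φ.col (s.pilot k))

/-- The maximum ratio transmission (MRT) direction `Y_l Φ e_{i_k}`. -/
def mrtDirection (l : Fin L) (k : Fin K) (ω : Ω) : Fin M → ℂ :=
  s.Hbar h N l ω *ᵥ Pi.single (s.pilot k) 1

/-- The full-pilot zero-forcing direction restricted to the pilots of the strong UEs,
`Y_l Φ E (Eᴴ (Y_l Φ)ᴴ Y_l Φ E)⁻¹ ε` with `E = E_{S_l}`; used for strong UEs `k` only. -/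
def zfDirection (l : Fin L) (k : Fin K) (ω : Ω) : Fin M → ℂ :=
  (s.Hbar h N l ω * s.selection l *
    ((s.selection l)ᴴ * (s.Hbar h N l ω)ᴴ * s.Hbar h N l ω * s.selection l)⁻¹) *ᵥ s.basisVec l k

end System

/-- A random vector divided by the square root of its mean squared Euclidean norm. -/
def normalized {Ω : Type*} [MeasurableSpace Ω] {M : ℕ} (P : Measure Ω) (v : Ω → Fin M → ℂ) (ω : Ω) :
    Fin M → ℂ :=
  (((√(∫ ω', vecNormSq (v ω') ∂P))⁻¹ : ℝ) : ℂ) • v ω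

namespace System

variable {L K τ M : ℕ} (s : System L K τ) {Ω : Type*} [MeasurableSpace Ω] (P : Measure Ω)
  (h : Fin L → Fin K → Ω → Fin M → ℂ) (N : Fin L → Ω → Matrix (Fin M) (Fin τ) ℂ)

/-- The MRT precoding vector of AP `l` towards UE `k`. -/
def mrt (l : Fin L) (k : Fin K) : Ω → Fin M → ℂ := normalized P (s.mrtDirection h N l k)

/-- The zero-forcing precoding vector of AP `l` towards its strong UE `k`. -/
def zf (l : Fin L) (k : Fin K) : Ω → Fin M → ℂ := normalized P (s.zfDirection h N l k)

/-- The local partial zero-forcing precoder: zero forcing to strong UEs, MRT to weak UEs. -/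
def precoder (l : Fin L) (k : Fin K) : Ω → Fin M → ℂ :=
  if k ∈ s.strong l then s.zf P h N l k else s.mrt P h N l k

/-- The effective scalar channel `h_{l,k}ᴴ w_{l,i_t}`. -/
def gain (l : Fin L) (k t : Fin K) (ω : Ω) : ℂ :=
  star (h l k ω) ⬝ᵥ s.precoder P h N l t ω

/-- The coherent precoding gain `CP_k`. -/
def CP (k : Fin K) : ℂ := ∑ l, ((√(s.ρ l k : ℝ) : ℝ) : ℂ) * ∫ ω, s.gain P h N l k k ω ∂P

/-- The precoding gain uncertainty `PU_k`. -/
def PU (k : Fin K) (ω : Ω) : ℂ :=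
  ∑ l, (((√(s.ρ l k : ℝ) : ℝ) : ℂ) * s.gain P h N l k k ω
    - ((√(s.ρ l k : ℝ) : ℝ) : ℂ) * ∫ ω', s.gain P h N l k k ω' ∂P)

/-- The multi-user interference `UI_{kt}`. -/
def UI (k t : Fin K) (ω : Ω) : ℂ := ∑ l, ((√(s.ρ l t : ℝ) : ℝ) : ℂ) * s.gain P h N l k t ω

/-- The effective SINR of the hardening bound,
`|CP_k|² / (E|PU_k|² + ∑_{t ≠ k} E|UI_{kt}|² + 1)`. -/
def effectiveSINR (k : Fin K) : ℝ :=
  ‖s.CP P h N k‖ ^ 2 /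
    (∫ ω, ‖s.PU P h N k ω‖ ^ 2 ∂P
      + ∑ t ∈ Finset.univ.erase k, ∫ ω, ‖s.UI P h N k t ω‖ ^ 2 ∂P + 1)

/-- The mean of the total gain seen by UE `k` for its own symbol, split into the APs at which UE `k`
is strong and those at which it is weak. -/
def meanGain (k : Fin K) : ℂ :=
  ∑ l with k ∈ s.strong l,
      ((√(s.ρ l k : ℝ) : ℝ) : ℂ) * ∫ ω, star (h l k ω) ⬝ᵥ s.zf P h N l k ω ∂P
    + ∑ l with k ∉ s.strong l,
      ((√(s.ρ l k : ℝ) : ℝ) : ℂ) * ∫ ω, star (h l k ω) ⬝ᵥ s.mrt P h N l k ω ∂P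

/-- The total gain seen by UE `k` for the symbol of UE `t`, split in the same way. -/
def totalGain (k t : Fin K) (ω : Ω) : ℂ :=
  ∑ l with t ∈ s.strong l,
      ((√(s.ρ l t : ℝ) : ℝ) : ℂ) * (star (h l k ω) ⬝ᵥ s.zf P h N l t ω)
    + ∑ l with t ∉ s.strong l,
      ((√(s.ρ l t : ℝ) : ℝ) : ℂ) * (star (h l k ω) ⬝ᵥ s.mrt P h N l t ω)

/-- The effective SINR of local partial zero-forcing, in terms of second moments of total gains. -/
def pzfSINR (k : Fin K) : ℝ :=
  ‖s.meanGain P h N k‖ ^ 2 /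
    (∑ t, ∫ ω, ‖s.totalGain P h N k t ω‖ ^ 2 ∂P - ‖s.meanGain P h N k‖ ^ 2 + 1)

/-- The closed form of the SINR. -/
def closedFormSINR (M : ℕ) (k : Fin K) : ℝ :=
  (∑ l, √(((M : ℝ) - s.δ l k * s.tauS l) * s.ρ l k * s.γ l k)) ^ 2 /
    (∑ t ∈ s.coPilot k \ {k},
        (∑ l, √(((M : ℝ) - s.δ l t * s.tauS l) * s.ρ l t * s.γ l k)) ^ 2
      + ∑ t, ∑ l, (s.ρ l t : ℝ) * ((s.β l k : ℝ) - s.δ l t * s.δ l k * s.γ l k) + 1)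

end System

/-- The downlink spectral efficiency (bit/s/Hz) that the hardening bound assigns to an effective
SINR; `ξ` is the downlink fraction of the data phase, `τ` and `τc` are the lengths of the uplink
training phase and of the whole frame. -/
def spectralEfficiency (ξ : ℝ) (τ τc : ℕ) (sinr : ℝ) : ℝ :=
  ξ * (1 - (τ : ℝ) / τc) * Real.logb 2 (1 + sinr)

end CellFree

end

noncomputable section

namespace CellFree

open MeasureTheory ProbabilityTheory Matrix Complex
open scoped NNReal ENNReal ComplexConjugate RealInnerProductSpace

/-! Everything rests on one decomposition. At a fixed AP, the columns of `Hbar` and the error of the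
linear MMSE estimate of `h l k` are linear images of the same independent Gaussians (channels and
noise). They are uncorrelated, by orthogonality of the pilots and by the choice of `c`, hence
independent (`gaussianVector_map_linear`, `hasLaw_joint`). A precoder is a function of the columns
alone, so in `gain_eq` the error contributes a centred term, uncorrelated with the rest, of mean
square `β - γ` times the mean squared norm of the precoder, which is one
(`moments_add_dotProduct_gaussianVector`).

The contribution of the estimated part (`moments_estimateGain`) depends on the pilots and on the
groups. If both UEs are strong, zero forcing makes the inner product almost surely constant: zero
for different pilots, and otherwise the normalizing factor. If UE `t` is weak and shares the pilot
of UE `k`, the inner product is a multiple of the squared norm of a Gaussian vector, whose first two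
moments are explicit. In the remaining cases the precoder is independent of the column of UE `k`,
and the inner product is centred with mean square `γ`. Always, the mean is `gainMean` and the
variance is `γ`, or zero if both UEs are strong.

The normalizing factor of zero forcing requires the mean squared norm of a zero-forcing vector
(`lintegral_vecNormSq_zfVec`). Given the other columns, this squared norm is the inverse of the
squared norm of the projection of one Gaussian column to the orthogonal complement of the others,
which has dimension `M - τ_S + 1`. The mean of the inverse squared norm follows from the Laplace
transform and is finite because that dimension is at least two, that is, because `τ_S < M`.

Different APs see independent data, so over the APs the means add coherently and the variances add
incoherently (`integral_norm_sq_sum_of_indepFun`). These are the two sums in the denominator of the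
closed form. -/

/-! ### The scalar complex Gaussian law: characteristic function, density, moments. -/

lemma measurable_mk_complex : Measurable (fun z : ℝ × ℝ => (⟨z.1, z.2⟩ : ℂ)) :=
  Complex.measurableEquivRealProd.symm.measurable

instance (v : ℝ≥0) : IsProbabilityMeasure (complexGaussian v) :=
  Measure.isProbabilityMeasure_map measurable_mk_complex.aemeasurable

/-- The value depends on `t` only through its modulus, which is circular symmetry. Scaling, the
symmetry `z ↦ -z` and linear images are all read off from this formula. -/
lemma charFun_complexGaussian (v : ℝ≥0) (t : ℂ) :
    charFun (complexGaussian v) t = Complex.exp (-(v * ‖t‖ ^ 2 / 4 : ℝ)) := by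
  rw [charFun_apply, complexGaussian, integral_map measurable_mk_complex.aemeasurable (by fun_prop)]
  have h : ∀ z : ℝ × ℝ, Complex.exp (⟪(⟨z.1, z.2⟩ : ℂ), t⟫ * I) =
      Complex.exp (t.re * z.1 * I) * Complex.exp (t.im * z.2 * I) := by
    intro z
    rw [← Complex.exp_add, Complex.inner]
    congr 1
    simp
    ring
  simp_rw [h]
  rw [integral_prod_mul (fun x : ℝ => Complex.exp (t.re * x * I))
    (fun x : ℝ => Complex.exp (t.im * x * I)), ← charFun_apply_real, ← charFun_apply_real,
    charFun_gaussianReal, charFun_gaussianReal, ← Complex.exp_add]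
  congr 1
  rw [← Complex.normSq_eq_norm_sq, Complex.normSq_apply]
  push_cast
  ring

/-- Reduces every variance, including the degenerate `v = 0`, to the standard law and its density.
-/
lemma complexGaussian_map_mul (v : ℝ≥0) :
    (complexGaussian 1).map (fun z => ((√(v : ℝ) : ℝ) : ℂ) * z) = complexGaussian v := by
  apply Measure.ext_of_charFun
  ext t
  have := charFun_map_smul (μ := complexGaussian 1) (√(v : ℝ)) t
  simp only [Complex.real_smul] at this
  rw [this, charFun_complexGaussian, charFun_complexGaussian]
  simp only [norm_mul, Complex.norm_real, mul_pow, Real.norm_eq_abs, sq_abs,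
    Real.sq_sqrt v.coe_nonneg]
  simp

/-- The density of the standard complex Gaussian law. -/
lemma complexGaussian_one :
    complexGaussian 1 =
      volume.withDensity (fun z : ℂ => ENNReal.ofReal (Real.pi⁻¹ * Real.exp (-‖z‖ ^ 2))) := by
  have h2 : (1 / 2 : ℝ≥0) ≠ 0 := by norm_num
  rw [complexGaussian, gaussianReal_of_var_ne_zero 0 h2,
    prod_withDensity (by fun_prop) (by fun_prop)]
  have hmap := (Complex.volume_preserving_equiv_real_prod.symm
    Complex.measurableEquivRealProd).map_eq
  ext s hs
  rw [Measure.map_apply measurable_mk_complex hs,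
    withDensity_apply _ (measurable_mk_complex hs), withDensity_apply _ hs]
  rw [← hmap, Measure.restrict_map (MeasurableEquiv.measurable _) hs, lintegral_map_equiv]
  refine lintegral_congr fun z => ?_
  rw [gaussianPDF, gaussianPDF, ← ENNReal.ofReal_mul (gaussianPDFReal_nonneg _ _ _)]
  congr 1
  simp only [gaussianPDFReal]
  have hn : ‖Complex.measurableEquivRealProd.symm z‖ ^ 2 = z.1 ^ 2 + z.2 ^ 2 := by
    rw [← Complex.normSq_eq_norm_sq, Complex.normSq_apply]
    simp [Complex.measurableEquivRealProd, sq]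
  rw [hn, mul_mul_mul_comm, ← Real.exp_add, ← mul_inv]
  congr 2
  · simp
    rw [← sq, mul_right_comm, mul_inv_cancel₀ (by positivity), one_mul,
      Real.sq_sqrt Real.pi_pos.le]
  · simp
    ring

lemma lintegral_complexGaussian_one (f : ℂ → ℝ≥0∞) (hf : Measurable f) :
    ∫⁻ z, f z ∂complexGaussian 1 =
      ∫⁻ z, ENNReal.ofReal (Real.pi⁻¹ * Real.exp (-‖z‖ ^ 2)) * f z := by
  rw [complexGaussian_one, lintegral_withDensity_eq_lintegral_mul _ (by fun_prop) hf]
  rfl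

/-- The moments of the exponentially damped modulus of a standard complex Gaussian. -/
lemma lintegral_norm_pow_mul_exp_complexGaussian_one (n : ℕ) {s : ℝ} (hs : 0 ≤ s) :
    ∫⁻ z, ENNReal.ofReal (‖z‖ ^ (2 * n) * Real.exp (-s * ‖z‖ ^ 2)) ∂complexGaussian 1 =
      ENNReal.ofReal (n.factorial / (1 + s) ^ (n + 1)) := by
  have hs' : 0 < 1 + s := by linarith
  rw [lintegral_complexGaussian_one _ (by fun_prop)]
  -- The Gaussian density and the damping factor merge into a single exponential of rate `1 + s`;
  -- the radial integral is then a Gamma function.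
  have key := Complex.integral_rpow_mul_exp_neg_mul_rpow (p := 2) (q := (2 * n : ℕ)) (b := 1 + s)
    (by norm_num) (by have : (0 : ℝ) ≤ (2 * n : ℕ) := Nat.cast_nonneg _
                      linarith) hs'
  have hexp : -(((2 * n : ℕ) : ℝ) + 2) / 2 = -((n + 1 : ℕ) : ℝ) := by push_cast; ring
  have hgam : (((2 * n : ℕ) : ℝ) + 2) / 2 = (n : ℝ) + 1 := by push_cast; ring
  rw [hexp, hgam, Real.Gamma_nat_eq_factorial, Real.rpow_neg hs'.le, Real.rpow_natCast] at key
  simp only [Real.rpow_natCast, Real.rpow_two] at key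
  have hval : ∫ z : ℂ, Real.pi⁻¹ * (‖z‖ ^ (2 * n) * Real.exp (-(1 + s) * ‖z‖ ^ 2)) =
      n.factorial / (1 + s) ^ (n + 1) := by
    rw [integral_const_mul, key]
    field_simp [Real.pi_ne_zero]
  have hint : Integrable fun z : ℂ =>
      Real.pi⁻¹ * (‖z‖ ^ (2 * n) * Real.exp (-(1 + s) * ‖z‖ ^ 2)) := by
    -- The integral of a non-integrable function is zero by convention, so the positive value found
    -- above already proves integrability.
    apply Integrable.of_integral_ne_zero
    rw [hval]
    positivity
  rw [← hval, ofReal_integral_eq_lintegral_ofReal hint (ae_of_all _ fun z => by positivity)]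
  refine lintegral_congr fun z => ?_
  rw [← ENNReal.ofReal_mul (by positivity)]
  congr 1
  rw [show -(1 + s) * ‖z‖ ^ 2 = -‖z‖ ^ 2 + -s * ‖z‖ ^ 2 by ring, Real.exp_add]
  ring

/-- With `s = 0` these are the even moments; with `n = 0` it is the Laplace transform of the squared
modulus, used for inverse norms. -/
lemma lintegral_norm_pow_mul_exp_complexGaussian (v : ℝ≥0) (n : ℕ) {s : ℝ} (hs : 0 ≤ s) :
    ∫⁻ z, ENNReal.ofReal (‖z‖ ^ (2 * n) * Real.exp (-s * ‖z‖ ^ 2)) ∂complexGaussian v =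
      ENNReal.ofReal (v ^ n * n.factorial / (1 + v * s) ^ (n + 1)) := by
  rw [← complexGaussian_map_mul v, lintegral_map (by fun_prop) (by fun_prop)]
  have h : ∀ z : ℂ, ENNReal.ofReal (‖((√(v : ℝ) : ℝ) : ℂ) * z‖ ^ (2 * n) *
      Real.exp (-s * ‖((√(v : ℝ) : ℝ) : ℂ) * z‖ ^ 2)) =
      ENNReal.ofReal ((v : ℝ) ^ n) *
        ENNReal.ofReal (‖z‖ ^ (2 * n) * Real.exp (-(v * s) * ‖z‖ ^ 2)) := by
    intro z
    rw [← ENNReal.ofReal_mul (by positivity)]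
    congr 1
    simp only [pow_mul, norm_mul, Complex.norm_real, mul_pow, Real.norm_eq_abs, sq_abs,
      Real.sq_sqrt v.coe_nonneg]
    ring_nf
  simp_rw [h]
  rw [lintegral_const_mul _ (by fun_prop),
    lintegral_norm_pow_mul_exp_complexGaussian_one n (mul_nonneg v.coe_nonneg hs),
    ← ENNReal.ofReal_mul (by positivity), mul_div_assoc]

lemma lintegral_norm_pow_complexGaussian (v : ℝ≥0) (n : ℕ) :
    ∫⁻ z, ENNReal.ofReal (‖z‖ ^ (2 * n)) ∂complexGaussian v =
      ENNReal.ofReal (v ^ n * n.factorial) := by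
  simpa using lintegral_norm_pow_mul_exp_complexGaussian v n le_rfl

lemma integrable_norm_pow_complexGaussian (v : ℝ≥0) (n : ℕ) :
    Integrable (fun z => ‖z‖ ^ (2 * n)) (complexGaussian v) := by
  refine ⟨by fun_prop, ?_⟩
  rw [hasFiniteIntegral_iff_ofReal (ae_of_all _ fun z => by positivity),
    lintegral_norm_pow_complexGaussian]
  exact ENNReal.ofReal_lt_top

lemma integral_norm_pow_complexGaussian (v : ℝ≥0) (n : ℕ) :
    ∫ z, ‖z‖ ^ (2 * n) ∂complexGaussian v = v ^ n * n.factorial := by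
  rw [integral_eq_lintegral_of_nonneg_ae (ae_of_all _ fun z => by positivity) (by fun_prop),
    lintegral_norm_pow_complexGaussian, ENNReal.toReal_ofReal (by positivity)]

lemma integral_complexGaussian (v : ℝ≥0) : ∫ z, z ∂complexGaussian v = 0 := by
  have hneg : (complexGaussian v).map (fun z => -z) = complexGaussian v := by
    apply Measure.ext_of_charFun
    ext t
    have := charFun_map_smul (μ := complexGaussian v) (-1) t
    simp only [neg_smul, one_smul] at this
    rw [this, charFun_complexGaussian, charFun_complexGaussian, norm_neg]
  have h := integral_map (μ := complexGaussian v) (φ := fun z : ℂ => -z) (by fun_prop)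
    (f := fun z => z) (by fun_prop)
  rw [hneg, integral_neg] at h
  exact self_eq_neg.mp h

lemma complexGaussian_singleton_zero {v : ℝ≥0} (hv : v ≠ 0) :
    complexGaussian v {0} = 0 := by
  rw [← complexGaussian_map_mul, Measure.map_apply (by fun_prop) (measurableSet_singleton _)]
  have hpre : (fun z : ℂ => ((√(v : ℝ) : ℝ) : ℂ) * z) ⁻¹' {0} = {0} := by
    ext z
    simp [hv]
  rw [hpre, complexGaussian_one]
  exact withDensity_absolutelyContinuous _ _ (by simp)

/-! ### Gaussian vectors: linear images, subfamilies, independence. -/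

/-- The law of a family of independent circularly symmetric complex Gaussians. -/
def gaussianVector {ι : Type*} [Fintype ι] (v : ι → ℝ≥0) : Measure (ι → ℂ) :=
  Measure.pi fun i => complexGaussian (v i)

section Linear

variable {ι κ : Type*} [Fintype ι] [Fintype κ]

instance (v : ι → ℝ≥0) : IsProbabilityMeasure (gaussianVector v) :=
  inferInstanceAs (IsProbabilityMeasure (Measure.pi _))

/-- The hypothesis says that the image has the diagonal covariance `u`. The characteristic function
of a Gaussian vector depends on its covariance only, so uncorrelated linear forms are independent.
No variance needs to be positive. -/
lemma gaussianVector_map_linear [DecidableEq κ] (v : ι → ℝ≥0) (u : κ → ℝ≥0) (a : κ → ι → ℂ)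
    (hA : ∀ i i', ∑ j, a i j * ((v j : ℝ) : ℂ) * conj (a i' j) =
      if i = i' then ((u i : ℝ) : ℂ) else 0) :
    (gaussianVector v).map (fun x i => ∑ j, a i j * x j) = gaussianVector u := by
  have hprob : IsProbabilityMeasure ((gaussianVector v).map (fun x i => ∑ j, a i j * x j)) :=
    Measure.isProbabilityMeasure_map (Measurable.aemeasurable (by fun_prop))
  refine charFun_eq_pi_iff.mp fun t => ?_
  -- `s` is the adjoint matrix applied to `t`, which moves the linear map to the other side of the
  -- inner product.
  set s : PiLp 2 (fun _ : ι => ℂ) := WithLp.toLp 2 (fun j => ∑ i, conj (a i j) * t i) with hs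
  have h1 : charFun (((gaussianVector v).map (fun x i => ∑ j, a i j * x j)).map (WithLp.toLp 2)) t =
      charFun ((gaussianVector v).map (WithLp.toLp 2)) s := by
    rw [charFun_apply, charFun_apply, integral_map (by fun_prop) (by fun_prop),
      integral_map (Measurable.aemeasurable (by fun_prop)) (by fun_prop),
      integral_map (by fun_prop) (by fun_prop)]
    congr 1
    ext x
    congr 3
    simp only [PiLp.inner_apply, Complex.inner, hs]
    rw [← Complex.re_sum, ← Complex.re_sum]
    congr 1
    simp only [map_sum, map_mul, Finset.sum_mul, Finset.mul_sum]
    rw [Finset.sum_comm]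
    refine Finset.sum_congr rfl fun j _ => Finset.sum_congr rfl fun i _ => ?_
    ring
  rw [h1, gaussianVector, charFun_pi]
  simp only [charFun_complexGaussian]
  rw [← Complex.exp_sum, ← Complex.exp_sum]
  congr 1
  rw [Finset.sum_neg_distrib, Finset.sum_neg_distrib]
  congr 1
  have hsq : ∀ z : ℂ, ((‖z‖ ^ 2 : ℝ) : ℂ) = z * conj z := fun z => by
    rw [Complex.mul_conj, Complex.normSq_eq_norm_sq]
  have h2 : ∑ j, ((v j : ℝ) : ℂ) * ((‖s j‖ ^ 2 : ℝ) : ℂ) =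
      ∑ i, ((u i : ℝ) : ℂ) * ((‖t i‖ ^ 2 : ℝ) : ℂ) := by
    have e1 : ∀ j, ((v j : ℝ) : ℂ) * ((‖s j‖ ^ 2 : ℝ) : ℂ) =
        ∑ i, ∑ i', (a i' j * ((v j : ℝ) : ℂ) * conj (a i j)) * (t i * conj (t i')) := by
      intro j
      simp only [hsq, hs, map_sum, map_mul, Complex.conj_conj]
      rw [Finset.sum_mul_sum, Finset.mul_sum]
      refine Finset.sum_congr rfl fun i _ => ?_
      rw [Finset.mul_sum]
      refine Finset.sum_congr rfl fun i' _ => ?_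
      ring
    simp_rw [e1]
    rw [Finset.sum_comm]
    refine Finset.sum_congr rfl fun i _ => ?_
    rw [Finset.sum_comm]
    simp_rw [← Finset.sum_mul, hA, hsq]
    simp
  have h3 := congrArg (fun z : ℂ => z / 4) h2
  simp only [Finset.sum_div] at h3
  calc _ = _ := Finset.sum_congr rfl fun j _ => by push_cast; ring
    _ = _ := h3
    _ = _ := Finset.sum_congr rfl fun j _ => by push_cast; ring

variable {Ω : Type*} [MeasurableSpace Ω] {P : Measure Ω}

lemma hasLaw_gaussianVector_linear [DecidableEq κ] {v : ι → ℝ≥0} {X : Ω → ι → ℂ}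
    (hX : HasLaw X (gaussianVector v) P) (u : κ → ℝ≥0) (a : κ → ι → ℂ)
    (hA : ∀ i i', ∑ j, a i j * ((v j : ℝ) : ℂ) * conj (a i' j) =
      if i = i' then ((u i : ℝ) : ℂ) else 0) :
    HasLaw (fun ω i => ∑ j, a i j * X ω j) (gaussianVector u) P :=
  HasLaw.fun_comp (Y := fun x i => ∑ j, a i j * x j)
    ⟨Measurable.aemeasurable (by fun_prop), gaussianVector_map_linear v u a hA⟩ hX

lemma hasLaw_gaussianVector_comp {v : ι → ℝ≥0} {X : Ω → ι → ℂ}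
    (hX : HasLaw X (gaussianVector v) P) {e : κ → ι} (he : Function.Injective e) :
    HasLaw (fun ω i => X ω (e i)) (gaussianVector fun i => v (e i)) P := by
  classical
  have h := hasLaw_gaussianVector_linear hX (fun i => v (e i))
    (fun i j => if j = e i then 1 else 0) (by
      intro i i'
      by_cases h : i = i'
      · simp [h]
      · simp [he.eq_iff, h, Ne.symm h])
  simpa using h

lemma hasLaw_gaussianVector_eval {v : ι → ℝ≥0} {X : Ω → ι → ℂ}
    (hX : HasLaw X (gaussianVector v) P) (i : ι) :
    HasLaw (fun ω => X ω i) (complexGaussian (v i)) P :=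
  HasLaw.fun_comp (measurePreserving_eval (fun i => complexGaussian (v i)) i).hasLaw hX

/-- Disjoint parts of a Gaussian vector are independent. -/
lemma hasLaw_gaussianVector_prod {α β : Type*} [Fintype α] [Fintype β] {v : ι → ℝ≥0}
    {X : Ω → ι → ℂ} (hX : HasLaw X (gaussianVector v) P) {e : α → ι} {f : β → ι}
    (he : Function.Injective (Sum.elim e f)) :
    HasLaw (fun ω => ((fun a => X ω (e a)), fun b => X ω (f b)))
      ((gaussianVector fun a => v (e a)).prod (gaussianVector fun b => v (f b))) P :=
  HasLaw.fun_comp (measurePreserving_sumPiEquivProdPi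
    fun i => complexGaussian (v (Sum.elim e f i))).hasLaw (hasLaw_gaussianVector_comp hX he)

lemma indepFun_gaussianVector {α β : Type*} [Fintype α] [Fintype β] {v : ι → ℝ≥0}
    {X : Ω → ι → ℂ} (hX : HasLaw X (gaussianVector v) P) {e : α → ι} {f : β → ι}
    (he : Function.Injective (Sum.elim e f)) :
    IndepFun (fun ω a => X ω (e a)) (fun ω b => X ω (f b)) P := by
  have := hX.isProbabilityMeasure
  exact (indepFun_iff_hasLaw_prodMk_prod
    (hasLaw_gaussianVector_comp hX (he.comp Sum.inl_injective))
    (hasLaw_gaussianVector_comp hX (he.comp Sum.inr_injective))).mpr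
    (hasLaw_gaussianVector_prod hX he)

lemma iIndepFun_gaussianVector {v : ι → ℝ≥0} {X : Ω → ι → ℂ}
    (hX : HasLaw X (gaussianVector v) P) : iIndepFun (fun i ω => X ω i) P := by
  have := hX.isProbabilityMeasure
  exact (iIndepFun_iff_hasLaw_pi_pi fun i => hasLaw_gaussianVector_eval hX i).mpr hX

end Linear

/-! ### Moments of the squared norm of a Gaussian vector and of its inverse. -/

section Moments

variable {ι : Type*} [Fintype ι] {Ω : Type*} [MeasurableSpace Ω] {P : Measure Ω}
  {v : ι → ℝ≥0} {X : Ω → ι → ℂ}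

lemma integrable_norm_pow_gaussianVector (hX : HasLaw X (gaussianVector v) P) (i : ι) (n : ℕ) :
    Integrable (fun ω => ‖X ω i‖ ^ (2 * n)) P := by
  have h := hasLaw_gaussianVector_eval hX i
  have h2 := integrable_norm_pow_complexGaussian (v i) n
  rw [← h.map_eq] at h2
  exact h2.comp_aemeasurable h.aemeasurable

lemma integral_norm_pow_gaussianVector (hX : HasLaw X (gaussianVector v) P) (i : ι) (n : ℕ) :
    ∫ ω, ‖X ω i‖ ^ (2 * n) ∂P = v i ^ n * n.factorial := by
  have h := hasLaw_gaussianVector_eval hX i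
  rw [← integral_norm_pow_complexGaussian]
  exact h.integral_comp (f := fun z => ‖z‖ ^ (2 * n)) (by fun_prop)

lemma integral_gaussianVector (hX : HasLaw X (gaussianVector v) P) (i : ι) :
    ∫ ω, X ω i ∂P = 0 := by
  rw [← integral_complexGaussian (v i)]
  exact (hasLaw_gaussianVector_eval hX i).integral_eq

lemma memLp_gaussianVector (hX : HasLaw X (gaussianVector v) P) (i : ι) :
    MemLp (fun ω => X ω i) 2 P := by
  have hm := (hasLaw_gaussianVector_eval hX i).aemeasurable
  rw [memLp_two_iff_integrable_sq_norm hm.aestronglyMeasurable]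
  simpa using integrable_norm_pow_gaussianVector hX i 1

lemma integral_mul_conj_gaussianVector [DecidableEq ι] (hX : HasLaw X (gaussianVector v) P)
    (i j : ι) : ∫ ω, X ω i * conj (X ω j) ∂P = if i = j then ((v i : ℝ) : ℂ) else 0 := by
  have hm i := (hasLaw_gaussianVector_eval hX i).aemeasurable
  split_ifs with h
  · subst h
    have := integral_norm_pow_gaussianVector hX i 1
    simp only [mul_one, pow_one, Nat.factorial_one, Nat.cast_one] at this
    rw [← this, ← integral_complex_ofReal]
    refine integral_congr_ae (ae_of_all _ fun ω => ?_)
    simp [Complex.mul_conj, Complex.normSq_eq_norm_sq]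
  · have hind := (iIndepFun_gaussianVector hX).indepFun h
    rw [hind.integral_fun_comp_mul_comp (f := fun z => z) (g := fun z => conj z) (hm i) (hm j)
      (by fun_prop) (by fun_prop), integral_gaussianVector hX, zero_mul]

variable {u : ℝ≥0}

lemma integral_sum_norm_sq_gaussianVector (hX : HasLaw X (gaussianVector fun _ => u) P) :
    ∫ ω, ∑ i, ‖X ω i‖ ^ 2 ∂P = Fintype.card ι * u := by
  rw [integral_finsetSum _ fun i _ => by simpa using integrable_norm_pow_gaussianVector hX i 1]
  have h : ∀ i, ∫ ω, ‖X ω i‖ ^ 2 ∂P = u := fun i => by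
    simpa using integral_norm_pow_gaussianVector hX i 1
  simp [h]

lemma integrable_norm_sq_mul_norm_sq_gaussianVector (hX : HasLaw X (gaussianVector v) P)
    (i j : ι) : Integrable (fun ω => ‖X ω i‖ ^ 2 * ‖X ω j‖ ^ 2) P := by
  have hmem : ∀ i, MemLp (fun ω => ‖X ω i‖ ^ 2) 2 P := fun i => by
    have hm := (hasLaw_gaussianVector_eval hX i).aemeasurable
    rw [memLp_two_iff_integrable_sq (by fun_prop)]
    simpa [← pow_mul] using integrable_norm_pow_gaussianVector hX i 2
  exact (hmem i).integrable_mul (hmem j)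

lemma integrable_sum_norm_sq_sq_gaussianVector (hX : HasLaw X (gaussianVector v) P) :
    Integrable (fun ω => (∑ i, ‖X ω i‖ ^ 2) ^ 2) P := by
  simp_rw [sq (∑ i, _), Finset.sum_mul_sum]
  exact integrable_finsetSum _ fun i _ => integrable_finsetSum _ fun j _ =>
    integrable_norm_sq_mul_norm_sq_gaussianVector hX i j

/-- Among the pairs of entries, each off-diagonal one contributes `u ^ 2` by independence and each
diagonal one the fourth moment `2 * u ^ 2`. -/
lemma integral_sum_norm_sq_sq_gaussianVector (hX : HasLaw X (gaussianVector fun _ => u) P) :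
    ∫ ω, (∑ i, ‖X ω i‖ ^ 2) ^ 2 ∂P = u ^ 2 * (Fintype.card ι * (Fintype.card ι + 1)) := by
  classical
  simp_rw [sq (∑ i, _), Finset.sum_mul_sum]
  rw [integral_finsetSum _ fun i _ => integrable_finsetSum _ fun j _ =>
    integrable_norm_sq_mul_norm_sq_gaussianVector hX i j]
  have hm i := (hasLaw_gaussianVector_eval hX i).aemeasurable
  have h1 : ∀ i, ∫ ω, ‖X ω i‖ ^ 2 ∂P = u := fun i => by
    simpa using integral_norm_pow_gaussianVector hX i 1
  have h2 : ∀ i j, ∫ ω, ‖X ω i‖ ^ 2 * ‖X ω j‖ ^ 2 ∂P =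
      (u : ℝ) ^ 2 + if i = j then (u : ℝ) ^ 2 else 0 := by
    intro i j
    split_ifs with h
    · subst h
      simp_rw [← pow_add]
      have := integral_norm_pow_gaussianVector hX i 2
      norm_num at this ⊢
      rw [this]
      ring
    · rw [((iIndepFun_gaussianVector hX).indepFun h).integral_fun_comp_mul_comp
        (f := fun z => ‖z‖ ^ 2) (g := fun z => ‖z‖ ^ 2) (hm i) (hm j) (by fun_prop) (by fun_prop),
        h1, h1]
      ring
  have h3 : ∀ i, ∫ ω, ∑ j, ‖X ω i‖ ^ 2 * ‖X ω j‖ ^ 2 ∂P =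
      (Fintype.card ι + 1) * (u : ℝ) ^ 2 := by
    intro i
    rw [integral_finsetSum _ fun j _ => integrable_norm_sq_mul_norm_sq_gaussianVector hX i j]
    simp_rw [h2, Finset.sum_add_distrib]
    simp
    ring
  simp_rw [h3]
  simp
  ring

lemma ae_ne_zero_gaussianVector (hX : HasLaw X (gaussianVector v) P) {i : ι} (hi : v i ≠ 0) :
    ∀ᵐ ω ∂P, X ω i ≠ 0 := by
  have h := hasLaw_gaussianVector_eval hX i
  have h0 : ∀ᵐ z ∂complexGaussian (v i), z ≠ 0 := by
    rw [ae_iff]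
    simpa using complexGaussian_singleton_zero hi
  rw [← h.map_eq] at h0
  exact ae_of_ae_map h.aemeasurable h0

/-- Writing an inverse as an integral of exponentials reduces the mean of an inverse norm to a
Laplace transform. -/
lemma lintegral_exp_neg_Ioi {x : ℝ} (hx : 0 < x) :
    ∫⁻ s in Set.Ioi (0 : ℝ), ENNReal.ofReal (Real.exp (-s * x)) = ENNReal.ofReal x⁻¹ := by
  have h := integral_exp_mul_Ioi (a := -x) (by linarith) 0
  have hi : IntegrableOn (fun s => Real.exp (-x * s)) (Set.Ioi 0) :=
    integrableOn_exp_mul_Ioi (by linarith) 0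
  simp only [mul_zero, Real.exp_zero, neg_div_neg_eq, one_div] at h
  rw [← h, ofReal_integral_eq_lintegral_ofReal hi (ae_of_all _ fun s => by positivity)]
  simp [mul_comm]

lemma lintegral_inv_pow_Ioi {u : ℝ} (hu : 0 < u) (n : ℕ) :
    ∫⁻ s in Set.Ioi (0 : ℝ), ENNReal.ofReal (((1 + u * s) ^ (n + 2))⁻¹) =
      ENNReal.ofReal ((u * (n + 1))⁻¹) := by
  have hderiv : ∀ x ∈ Set.Ioi (0 : ℝ), HasDerivAt
      (fun s => -((u * (n + 1))⁻¹) * ((1 + u * s) ^ (n + 1))⁻¹) (((1 + u * x) ^ (n + 2))⁻¹) x := by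
    intro x hx
    have hpos : 0 < 1 + u * x := by
      have := mul_pos hu hx
      linarith
    have h1 : HasDerivAt (fun s => 1 + u * s) u x := by
      simpa using ((hasDerivAt_id x).const_mul u).const_add 1
    have h2 := ((h1.pow (n + 1)).inv (pow_pos hpos _).ne').const_mul (-((u * (n + 1))⁻¹))
    convert! h2 using 1
    have : (n : ℝ) + 1 ≠ 0 := by positivity
    simp
    field_simp
    ring
  have hcont : ContinuousWithinAt (fun s => -((u * (n + 1))⁻¹) * ((1 + u * s) ^ (n + 1))⁻¹)
      (Set.Ici (0 : ℝ)) 0 := by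
    apply ContinuousAt.continuousWithinAt
    refine ContinuousAt.mul continuousAt_const (ContinuousAt.inv₀ (by fun_prop) (by simp))
  have htend : Filter.Tendsto (fun s => -((u * (n + 1))⁻¹) * ((1 + u * s) ^ (n + 1))⁻¹)
      Filter.atTop (nhds 0) := by
    rw [show (0 : ℝ) = -((u * (n + 1))⁻¹) * 0 by simp]
    refine Filter.Tendsto.const_mul _ (Filter.Tendsto.inv_tendsto_atTop ?_)
    refine (Filter.tendsto_pow_atTop (by simp)).comp ?_
    exact Filter.tendsto_atTop_add_const_left _ _ (Filter.tendsto_id.const_mul_atTop hu)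
  have hpos : ∀ x ∈ Set.Ioi (0 : ℝ), 0 ≤ ((1 + u * x) ^ (n + 2))⁻¹ := fun x hx => by
    have := mul_pos hu hx
    positivity
  have hint := integrableOn_Ioi_deriv_of_nonneg hcont hderiv hpos htend
  rw [← ofReal_integral_eq_lintegral_ofReal hint
    ((ae_restrict_iff' measurableSet_Ioi).mpr (ae_of_all _ hpos)),
    integral_Ioi_of_hasDerivAt_of_nonneg hcont hderiv hpos htend]
  simp

lemma lintegral_exp_neg_sum_gaussianVector (hX : HasLaw X (gaussianVector fun _ => u) P)
    {s : ℝ} (hs : 0 ≤ s) :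
    ∫⁻ ω, ENNReal.ofReal (Real.exp (-s * ∑ i, ‖X ω i‖ ^ 2)) ∂P =
      ENNReal.ofReal (((1 + u * s) ^ Fintype.card ι)⁻¹) := by
  have h1 := HasLaw.lintegral_comp hX
    (f := fun x => ENNReal.ofReal (Real.exp (-s * ∑ i, ‖x i‖ ^ 2)))
    (Measurable.aemeasurable (by fun_prop))
  rw [h1]
  have h2 : ∀ x : ι → ℂ, ENNReal.ofReal (Real.exp (-s * ∑ i, ‖x i‖ ^ 2)) =
      ∏ i, ENNReal.ofReal (Real.exp (-s * ‖x i‖ ^ 2)) := by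
    intro x
    rw [Finset.mul_sum, Real.exp_sum, ENNReal.ofReal_prod_of_nonneg fun i _ => by positivity]
  have hind := (iIndepFun_gaussianVector (HasLaw.id (μ := gaussianVector fun _ : ι => u))).comp
    (fun _ z => ENNReal.ofReal (Real.exp (-s * ‖z‖ ^ 2))) fun i => by fun_prop
  have h4 := lintegral_prod_eq_prod_lintegral_of_indepFun Finset.univ _ hind fun i => by
    simp only [id]
    fun_prop
  simp only [Function.comp, id] at h4
  simp_rw [h2, h4]
  have h3 : ∫⁻ z, ENNReal.ofReal (Real.exp (-s * ‖z‖ ^ 2)) ∂complexGaussian u =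
      ENNReal.ofReal ((1 + u * s)⁻¹) := by
    simpa using lintegral_norm_pow_mul_exp_complexGaussian u 0 hs
  have h5 : ∀ i : ι, ∫⁻ x : ι → ℂ, ENNReal.ofReal (Real.exp (-s * ‖x i‖ ^ 2))
      ∂gaussianVector (fun _ => u) = ENNReal.ofReal ((1 + u * s)⁻¹) := by
    intro i
    rw [← h3]
    exact (hasLaw_gaussianVector_eval
      (HasLaw.id (μ := gaussianVector fun _ : ι => u)) i).lintegral_comp
      (f := fun z => ENNReal.ofReal (Real.exp (-s * ‖z‖ ^ 2))) (by fun_prop)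
  simp_rw [h5]
  rw [Finset.prod_const, Finset.card_univ, ← inv_pow, ENNReal.ofReal_pow (by positivity)]

/-- The mean of the inverse squared norm of a complex Gaussian vector. -/
lemma lintegral_inv_sum_norm_sq_gaussianVector (hX : HasLaw X (gaussianVector fun _ => u) P)
    (hu : u ≠ 0) {n : ℕ} (hn : Fintype.card ι = n + 2) :
    ∫⁻ ω, ENNReal.ofReal (∑ i, ‖X ω i‖ ^ 2)⁻¹ ∂P = ENNReal.ofReal ((u * (n + 1))⁻¹) := by
  have := hX.isProbabilityMeasure
  have : Nonempty ι := Fintype.card_pos_iff.mp (by omega)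
  have hm := hX.aemeasurable
  obtain ⟨i₀⟩ := this
  have h1 : ∫⁻ ω, ENNReal.ofReal (∑ i, ‖X ω i‖ ^ 2)⁻¹ ∂P = ∫⁻ ω, (∫⁻ s in Set.Ioi (0 : ℝ),
      ENNReal.ofReal (Real.exp (-s * ∑ i, ‖X ω i‖ ^ 2))) ∂P := by
    refine lintegral_congr_ae ?_
    -- The integral representation of the inverse needs a positive norm; at norm zero the inverse is
    -- zero by convention while the integral is infinite, so this null event is discarded.
    filter_upwards [ae_ne_zero_gaussianVector hX (i := i₀) hu] with ω hω
    rw [lintegral_exp_neg_Ioi]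
    exact Finset.sum_pos' (fun i _ => by positivity) ⟨i₀, Finset.mem_univ _, by positivity⟩
  -- Tonelli: no integrability is required, and finiteness comes out of the computation. The
  -- exponent `n + 2` is what makes the remaining integral over `s` converge.
  rw [h1, lintegral_lintegral_swap]
  · have hu' : 0 < (u : ℝ) := by positivity
    rw [← lintegral_inv_pow_Ioi hu' n]
    refine setLIntegral_congr_fun measurableSet_Ioi fun s hs => ?_
    rw [lintegral_exp_neg_sum_gaussianVector hX (le_of_lt hs), hn]
  · have : AEMeasurable (fun p : Ω × ℝ => X p.1) (P.prod (volume.restrict (Set.Ioi (0 : ℝ)))) :=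
      hm.comp_fst
    have h3 : Measurable (fun q : (ι → ℂ) × ℝ =>
      ENNReal.ofReal (Real.exp (-q.2 * ∑ i, ‖q.1 i‖ ^ 2))) := by fun_prop
    exact h3.comp_aemeasurable (this.prodMk measurable_snd.aemeasurable)

end Moments

lemma ofReal_norm_sq (z : ℂ) : ((‖z‖ ^ 2 : ℝ) : ℂ) = z * conj z := by
  rw [Complex.mul_conj, Complex.normSq_eq_norm_sq]

/-! ### Second moments of complex random variables and random linear forms. -/

section SecondMoments

variable {Ω : Type*} [MeasurableSpace Ω] {P : Measure Ω}

lemma memLp_two_conj {X : Ω → ℂ} (hX : MemLp X 2 P) : MemLp (fun ω => conj (X ω)) 2 P :=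
  hX.of_le (Complex.continuous_conj.comp_aestronglyMeasurable hX.1) (ae_of_all _ fun ω => by simp)

lemma integrable_mul_conj {X Y : Ω → ℂ} (hX : MemLp X 2 P) (hY : MemLp Y 2 P) :
    Integrable (fun ω => X ω * conj (Y ω)) P :=
  hX.integrable_mul (memLp_two_conj hY)

lemma ofReal_integral_norm_sq (X : Ω → ℂ) :
    ((∫ ω, ‖X ω‖ ^ 2 ∂P : ℝ) : ℂ) = ∫ ω, X ω * conj (X ω) ∂P := by
  rw [← integral_complex_ofReal]
  simp_rw [ofReal_norm_sq]

lemma integral_norm_sq_sum_of_orthogonal {ι : Type*} [Fintype ι] {X : ι → Ω → ℂ}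
    (hX : ∀ i, MemLp (X i) 2 P) (ho : ∀ i j, i ≠ j → ∫ ω, X i ω * conj (X j ω) ∂P = 0) :
    ∫ ω, ‖∑ i, X i ω‖ ^ 2 ∂P = ∑ i, ∫ ω, ‖X i ω‖ ^ 2 ∂P := by
  apply Complex.ofReal_injective
  rw [ofReal_integral_norm_sq, Complex.ofReal_sum]
  simp_rw [ofReal_integral_norm_sq, map_sum, Finset.sum_mul_sum]
  rw [integral_finsetSum _ fun i _ => integrable_finsetSum _ fun j _ =>
    integrable_mul_conj (hX i) (hX j)]
  refine Finset.sum_congr rfl fun i _ => ?_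
  rw [integral_finsetSum _ fun j _ => integrable_mul_conj (hX i) (hX j)]
  exact Finset.sum_eq_single i (fun j _ hj => ho i j hj.symm) (by simp)

lemma memLp_two_mul_of_indepFun {X Y : Ω → ℂ} (hX : MemLp X 2 P) (hY : MemLp Y 2 P)
    (h : IndepFun X Y P) : MemLp (fun ω => X ω * Y ω) 2 P := by
  rw [memLp_two_iff_integrable_sq_norm (f := fun ω => X ω * Y ω) (hX.1.mul hY.1)]
  have hi := (h.comp (φ := fun z => ‖z‖ ^ 2) (ψ := fun z => ‖z‖ ^ 2) (by fun_prop)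
    (by fun_prop)).integrable_mul ((memLp_two_iff_integrable_sq_norm hX.1).mp hX)
    ((memLp_two_iff_integrable_sq_norm hY.1).mp hY)
  refine hi.congr (ae_of_all _ fun ω => ?_)
  simp [mul_pow]

lemma integral_norm_sq_sub_mean [IsProbabilityMeasure P] {X : Ω → ℂ} (hX : MemLp X 2 P) :
    ∫ ω, ‖X ω - ∫ ω', X ω' ∂P‖ ^ 2 ∂P = ∫ ω, ‖X ω‖ ^ 2 ∂P - ‖∫ ω, X ω ∂P‖ ^ 2 := by
  set c := ∫ ω, X ω ∂P with hc
  have hXi : Integrable X P := hX.integrable one_le_two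
  have hconj : ∫ ω, conj (X ω) ∂P = conj c := integral_conj
  have hXc : Integrable (fun ω => conj (X ω)) P := (memLp_two_conj hX).integrable one_le_two
  apply Complex.ofReal_injective
  rw [ofReal_integral_norm_sq, Complex.ofReal_sub, ofReal_integral_norm_sq, ofReal_norm_sq]
  have h : ∀ ω, (X ω - c) * conj (X ω - c) =
      X ω * conj (X ω) - X ω * conj c - (c * conj (X ω) - c * conj c) := by
    intro ω
    rw [map_sub]
    ring
  simp_rw [h]
  have h1 : Integrable (fun ω => X ω * conj (X ω) - X ω * conj c) P :=
    (integrable_mul_conj hX hX).sub (hXi.mul_const _)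
  have h2 : Integrable (fun ω => c * conj (X ω) - c * conj c) P :=
    (hXc.const_mul _).sub (integrable_const _)
  rw [integral_sub h1 h2,
    integral_sub (integrable_mul_conj hX hX) (hXi.mul_const _),
    integral_sub (hXc.const_mul _) (integrable_const _), integral_mul_const, integral_const_mul,
    hconj, ← hc]
  simp

lemma memLp_two_of_integrable_vecNormSq {M : ℕ} {v : Ω → Fin M → ℂ} (hv : AEMeasurable v P)
    (hi : Integrable (fun ω => vecNormSq (v ω)) P) (m : Fin M) :
    MemLp (fun ω => v ω m) 2 P := by
  have hm : AEMeasurable (fun ω => v ω m) P := by fun_prop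
  rw [memLp_two_iff_integrable_sq_norm hm.aestronglyMeasurable]
  refine hi.mono' (by fun_prop) (ae_of_all _ fun ω => ?_)
  rw [Real.norm_of_nonneg (by positivity)]
  exact Finset.single_le_sum (f := fun m => ‖v ω m‖ ^ 2) (fun i _ => by positivity)
    (Finset.mem_univ m)

/-- First and second moments of a linear form in a Gaussian vector, with a random affine term and
random coefficients that are independent of the vector. -/
lemma moments_add_dotProduct_gaussianVector [IsProbabilityMeasure P] {M : ℕ} {𝓨 : Type*}
    [MeasurableSpace 𝓨] {Y : Ω → 𝓨} {g : Ω → Fin M → ℂ} {u : ℝ≥0}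
    (hg : HasLaw g (gaussianVector fun _ => u) P) (hY : AEMeasurable Y P) (hind : IndepFun Y g P)
    {A : 𝓨 → ℂ} (hA : Measurable A) {w : 𝓨 → Fin M → ℂ} (hw : Measurable w)
    (hA2 : MemLp (fun ω => A (Y ω)) 2 P)
    (hw2 : Integrable (fun ω => vecNormSq (w (Y ω))) P) :
    MemLp (fun ω => A (Y ω) + star (g ω) ⬝ᵥ w (Y ω)) 2 P ∧
    ∫ ω, (A (Y ω) + star (g ω) ⬝ᵥ w (Y ω)) ∂P = ∫ ω, A (Y ω) ∂P ∧
    ∫ ω, ‖A (Y ω) + star (g ω) ⬝ᵥ w (Y ω)‖ ^ 2 ∂P =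
      ∫ ω, ‖A (Y ω)‖ ^ 2 ∂P + u * ∫ ω, vecNormSq (w (Y ω)) ∂P := by
  have hgm : AEMeasurable g P := hg.aemeasurable
  have hwm : ∀ m, Measurable fun y => w y m := fun m => by fun_prop
  have hw2' := memLp_two_of_integrable_vecNormSq (v := fun ω => w (Y ω)) (by fun_prop) hw2
  have hterm : ∀ m, MemLp (fun ω => conj (g ω m) * w (Y ω) m) 2 P := fun m =>
    memLp_two_mul_of_indepFun (memLp_two_conj (memLp_gaussianVector hg m)) (hw2' m)
      (hind.symm.comp (φ := fun x : Fin M → ℂ => conj (x m)) (ψ := fun y => w y m) (by fun_prop)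
        (hwm m))
  -- The affine term becomes the `none` summand. All summands are pairwise orthogonal in L², so the
  -- second moment is the sum of theirs.
  have hdot : ∀ ω, A (Y ω) + star (g ω) ⬝ᵥ w (Y ω) =
      ∑ o : Option (Fin M), o.elim (A (Y ω)) fun m => conj (g ω m) * w (Y ω) m := by
    intro ω
    simp [Fintype.sum_option, dotProduct]
  have hmem : ∀ o : Option (Fin M),
      MemLp (fun ω => o.elim (A (Y ω)) fun m => conj (g ω m) * w (Y ω) m) 2 P := by
    rintro (_ | m)
    · exact hA2
    · exact hterm m
  have hgc : ∀ m, ∫ ω, conj (g ω m) ∂P = 0 := fun m => by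
    rw [integral_conj, integral_gaussianVector hg, map_zero]
  have hfac : ∀ (f : (Fin M → ℂ) → ℂ) (b : 𝓨 → ℂ), Measurable f → Measurable b →
      ∫ ω, f (g ω) * b (Y ω) ∂P = (∫ ω, f (g ω) ∂P) * ∫ ω, b (Y ω) ∂P := fun f b hf hb =>
    hind.symm.integral_fun_comp_mul_comp hgm hY hf.aestronglyMeasurable hb.aestronglyMeasurable
  have hcross : ∀ m, ∫ ω, conj (g ω m) * w (Y ω) m * conj (A (Y ω)) ∂P = 0 := by
    intro m
    have := hfac (fun x => conj (x m)) (fun y => w y m * conj (A y)) (by fun_prop) (by fun_prop)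
    simp_rw [mul_assoc]
    rw [this, hgc, zero_mul]
  have hpair : ∀ m m', ∫ ω, conj (g ω m) * w (Y ω) m * conj (conj (g ω m') * w (Y ω) m') ∂P =
      (if m' = m then ((u : ℝ) : ℂ) else 0) * ∫ ω, w (Y ω) m * conj (w (Y ω) m') ∂P := by
    intro m m'
    have := hfac (fun x => x m' * conj (x m)) (fun y => w y m * conj (w y m')) (by fun_prop)
      (by fun_prop)
    rw [integral_mul_conj_gaussianVector hg] at this
    rw [← this]
    refine integral_congr_ae (ae_of_all _ fun ω => ?_)
    simp only [map_mul, Complex.conj_conj]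
    ring
  refine ⟨?_, ?_, ?_⟩
  · simp_rw [hdot]
    exact memLp_finsetSum _ fun o _ => hmem o
  · simp_rw [hdot]
    rw [integral_finsetSum _ fun o _ => (hmem o).integrable one_le_two, Fintype.sum_option]
    have h0 : ∀ m, ∫ ω, conj (g ω m) * w (Y ω) m ∂P = 0 := fun m => by
      rw [hfac (fun x => conj (x m)) (fun y => w y m) (by fun_prop) (hwm m), hgc, zero_mul]
    simp [h0]
  · simp_rw [hdot]
    rw [integral_norm_sq_sum_of_orthogonal hmem, Fintype.sum_option]
    · congr 1
      simp only [vecNormSq, Option.elim]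
      rw [integral_finsetSum _ fun m _ => (memLp_two_iff_integrable_sq_norm (hw2' m).1).mp (hw2' m),
        Finset.mul_sum]
      refine Finset.sum_congr rfl fun m _ => ?_
      apply Complex.ofReal_injective
      rw [ofReal_integral_norm_sq, hpair, Complex.ofReal_mul, ofReal_integral_norm_sq, if_pos rfl]
    · rintro (_ | m) (_ | m') hne
      · exact absurd rfl hne
      · have h := congrArg conj (hcross m')
        rw [← integral_conj, map_zero] at h
        rw [← h]
        refine integral_congr_ae (ae_of_all _ fun ω => ?_)
        simp only [Option.elim, map_mul, Complex.conj_conj]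
        ring
      · exact hcross m
      · have hne' : m' ≠ m := fun h => hne (by rw [h])
        simpa [hne'] using hpair m m'

end SecondMoments

/-! ### Geometry of zero-forcing vectors. -/

section LinearAlgebra

variable {M : ℕ} {κ : Type*} [Fintype κ] [DecidableEq κ]

lemma ofReal_vecNormSq (v : Fin M → ℂ) : (vecNormSq v : ℂ) = star v ⬝ᵥ v := by
  rw [vecNormSq, Complex.ofReal_sum]
  refine Finset.sum_congr rfl fun m _ => ?_
  rw [ofReal_norm_sq, mul_comm]
  rfl

lemma vecNormSq_smul (a : ℂ) (v : Fin M → ℂ) : vecNormSq (a • v) = ‖a‖ ^ 2 * vecNormSq v := by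
  simp [vecNormSq, mul_pow, Finset.mul_sum]

lemma vecNormSq_nonneg (v : Fin M → ℂ) : 0 ≤ vecNormSq v :=
  Finset.sum_nonneg fun _ _ => by positivity

/-- The rows of `B` form an orthonormal basis of the orthogonal complement of a linearly
independent family `W`. -/
lemma exists_orthonormal_complement {ι : Type*} [Fintype ι] (W : ι → Fin M → ℂ)
    (hW : LinearIndependent ℂ W) {n : ℕ} (hn : Fintype.card ι + n = M) :
    ∃ B : Matrix (Fin n) (Fin M) ℂ, B * Bᴴ = 1 ∧ (∀ j, B *ᵥ W j = 0) ∧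
      ∀ v, (∀ j, star (W j) ⬝ᵥ v = 0) → Bᴴ *ᵥ (B *ᵥ v) = v := by
  let W' : ι → EuclideanSpace ℂ (Fin M) := fun j => WithLp.toLp 2 (W j)
  have hW' : LinearIndependent ℂ W' :=
    hW.map' (WithLp.linearEquiv 2 ℂ (Fin M → ℂ)).symm.toLinearMap (LinearEquiv.ker _)
  let V : Submodule ℂ (EuclideanSpace ℂ (Fin M)) := Submodule.span ℂ (Set.range W')
  have hdim : Module.finrank ℂ V = Fintype.card ι := finrank_span_eq_card hW'
  have hdim' : Module.finrank ℂ Vᗮ = n :=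
    V.finrank_add_finrank_orthogonal' (by rw [hdim, hn]; simp)
  let b : OrthonormalBasis (Fin n) ℂ Vᗮ := (stdOrthonormalBasis ℂ Vᗮ).reindex (finCongr hdim')
  -- The conjugates turn multiplication by `B` into taking coordinates in the basis `b`, as `inner`
  -- is conjugate linear in its first argument.
  let B : Matrix (Fin n) (Fin M) ℂ := Matrix.of fun r m => conj ((b r : EuclideanSpace ℂ (Fin M)) m)
  have hB : ∀ (v : Fin M → ℂ) r, (B *ᵥ v) r =
      inner ℂ (b r : EuclideanSpace ℂ (Fin M)) (WithLp.toLp 2 v) := by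
    intro v r
    simp [B, Matrix.mulVec, dotProduct, PiLp.inner_apply, mul_comm]
  refine ⟨B, ?_, ?_, ?_⟩
  · ext r r'
    have h := orthonormal_iff_ite.mp b.orthonormal r r'
    rw [Matrix.one_apply, ← h, Submodule.coe_inner]
    simp [B, Matrix.mul_apply, PiLp.inner_apply, mul_comm]
  · intro j
    ext r
    rw [hB]
    exact Submodule.inner_left_of_mem_orthogonal (Submodule.subset_span (Set.mem_range_self j))
      (b r).2
  · intro v hv
    have hmem : (WithLp.toLp 2 v : EuclideanSpace ℂ (Fin M)) ∈ Vᗮ := by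
      rw [Submodule.mem_orthogonal]
      intro x hx
      induction hx using Submodule.span_induction with
      | mem x hx =>
        obtain ⟨j, rfl⟩ := hx
        rw [← hv j]
        simp [W', dotProduct, PiLp.inner_apply, mul_comm]
      | zero => simp
      | add x y _ _ hx hy => rw [inner_add_left, hx, hy, add_zero]
      | smul a x _ hx => rw [inner_smul_left, hx, mul_zero]
    have hsum := b.sum_repr' ⟨_, hmem⟩
    have hsum' := congrArg (fun x : Vᗮ => (x : EuclideanSpace ℂ (Fin M))) hsum
    ext m
    have hm := congrArg (fun x : EuclideanSpace ℂ (Fin M) => x m) hsum'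
    simp only [Submodule.coe_sum, Submodule.coe_smul, Submodule.coe_inner, WithLp.ofLp_sum,
      Finset.sum_apply, PiLp.smul_apply, smul_eq_mul] at hm
    rw [← hm, Matrix.mulVec, dotProduct]
    refine Finset.sum_congr rfl fun r _ => ?_
    rw [hB]
    simp [B, mul_comm]

/-- The zero-forcing vector of a column of a matrix: it is orthogonal to all the other columns. -/
def zfVec (Z : Matrix (Fin M) κ ℂ) (i : κ) : Fin M → ℂ := (Z * (Zᴴ * Z)⁻¹) *ᵥ Pi.single i 1

open scoped ComplexOrder in
-- Independence of the columns makes the Gram matrix positive definite, so that its inverse is a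
-- true one.
lemma conjTranspose_mulVec_zfVec {Z : Matrix (Fin M) κ ℂ} (hZ : LinearIndependent ℂ Z.col)
    (i : κ) : Zᴴ *ᵥ zfVec Z i = Pi.single i 1 := by
  have hpos : (Zᴴ * Z).PosDef := .conjTranspose_mul_self Z (Matrix.mulVec_injective_iff.mpr hZ)
  have hdet : IsUnit (Zᴴ * Z).det := hpos.det_pos.ne'.isUnit
  rw [zfVec, Matrix.mulVec_mulVec, ← Matrix.mul_assoc, Matrix.mul_nonsing_inv _ hdet,
    Matrix.one_mulVec]

lemma star_col_dotProduct_zfVec {Z : Matrix (Fin M) κ ℂ} (hZ : LinearIndependent ℂ Z.col)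
    (i j : κ) : star (Z.col j) ⬝ᵥ zfVec Z i = if j = i then 1 else 0 := by
  have h := congrFun (conjTranspose_mulVec_zfVec hZ i) j
  rw [Pi.single_apply] at h
  exact h

/-- The zero-forcing vector lies in the span of the columns and is orthogonal to all but the `i`-th.
It is therefore a multiple of the projection of that column to the complement of the others, and its
inner product with the column, equal to one, fixes the multiple. -/
lemma vecNormSq_zfVec {Z : Matrix (Fin M) κ ℂ} (hZ : LinearIndependent ℂ Z.col) (i : κ) {n : ℕ}
    {B : Matrix (Fin n) (Fin M) ℂ} (h0 : ∀ j, j ≠ i → B *ᵥ Z.col j = 0)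
    (hB : ∀ v, (∀ j, j ≠ i → star (Z.col j) ⬝ᵥ v = 0) → Bᴴ *ᵥ (B *ᵥ v) = v) :
    vecNormSq (zfVec Z i) = (vecNormSq (B *ᵥ Z.col i))⁻¹ := by
  set v := zfVec Z i with hv
  -- `c` is the coefficient of column `i` in the zero-forcing vector; `B` kills all the other
  -- columns.
  set c : ℂ := ((Zᴴ * Z)⁻¹ *ᵥ Pi.single i 1) i with hc
  have h1 : B *ᵥ v = c • (B *ᵥ Z.col i) := by
    have hcols : ∀ d : κ → ℂ, Z *ᵥ d = ∑ j, d j • Z.col j := by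
      intro d
      ext m
      simp [Matrix.mulVec, dotProduct, mul_comm]
    rw [hv, zfVec, ← Matrix.mulVec_mulVec, hcols, Matrix.mulVec_sum]
    simp_rw [Matrix.mulVec_smul]
    rw [Finset.sum_eq_single i (fun j _ hj => by rw [h0 j hj, smul_zero]) (by simp)]
  have h2 : Bᴴ *ᵥ (B *ᵥ v) = v := hB v fun j hj => by
    rw [hv, star_col_dotProduct_zfVec hZ, if_neg hj]
  have h3 : ∀ x : Fin M → ℂ, star x ⬝ᵥ v = star (B *ᵥ x) ⬝ᵥ (B *ᵥ v) := by
    intro x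
    conv_lhs => rw [← h2]
    rw [Matrix.dotProduct_mulVec, ← Matrix.star_mulVec]
  have h4 : c * vecNormSq (B *ᵥ Z.col i) = 1 := by
    have h := h3 (Z.col i)
    rw [hv, star_col_dotProduct_zfVec hZ, if_pos rfl, ← hv, h1, dotProduct_smul,
      ← ofReal_vecNormSq, smul_eq_mul] at h
    exact h.symm
  have h5 : vecNormSq v = ‖c‖ ^ 2 * vecNormSq (B *ᵥ Z.col i) := by
    apply Complex.ofReal_injective
    rw [ofReal_vecNormSq, h3, ← ofReal_vecNormSq, h1, vecNormSq_smul]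
  have hne : (vecNormSq (B *ᵥ Z.col i) : ℂ) ≠ 0 := right_ne_zero_of_mul_eq_one h4
  have hne' : vecNormSq (B *ᵥ Z.col i) ≠ 0 := by exact_mod_cast hne
  have h6 : c = ((vecNormSq (B *ᵥ Z.col i))⁻¹ : ℝ) := by
    rw [Complex.ofReal_inv]
    exact eq_inv_of_mul_eq_one_left h4
  rw [h5, h6, Complex.norm_real, Real.norm_eq_abs, sq_abs]
  field_simp

end LinearAlgebra

/-! ### Measurability of zero-forcing vectors and of linear independence. -/

section Measurability

variable {M : ℕ} {κ : Type*} [Fintype κ] [DecidableEq κ] {α : Type*} [MeasurableSpace α]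

lemma measurable_det {A : α → Matrix κ κ ℂ} (hA : ∀ i j, Measurable fun x => A x i j) :
    Measurable fun x => (A x).det := by
  simp_rw [Matrix.det_apply]
  refine Finset.measurable_sum _ fun σ _ => ?_
  refine Measurable.const_smul ?_ _
  exact Finset.measurable_prod _ fun i _ => hA _ _

lemma measurable_inv_apply {A : α → Matrix κ κ ℂ} (hA : ∀ i j, Measurable fun x => A x i j)
    (i j : κ) : Measurable fun x => (A x)⁻¹ i j := by
  -- The adjugate formula also covers singular matrices: both the matrix inverse and the inverse of
  -- the determinant are then zero.
  simp_rw [Matrix.inv_def, Ring.inverse_eq_inv', Matrix.smul_apply, smul_eq_mul,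
    Matrix.adjugate_apply]
  refine (measurable_det hA).inv.mul (measurable_det fun i' j' => ?_)
  by_cases h : i' = j
  · subst h
    simp
  · simpa [Matrix.updateRow_ne h] using hA i' j'

lemma measurable_zfVec {Z : α → Matrix (Fin M) κ ℂ} (hZ : ∀ m j, Measurable fun x => Z x m j)
    (i : κ) : Measurable fun x => zfVec (Z x) i := by
  refine measurable_pi_lambda _ fun m => ?_
  simp only [zfVec, Matrix.mulVec_single_one, Matrix.col_apply, Matrix.mul_apply]
  refine Finset.measurable_sum _ fun j _ => (hZ m j).mul (measurable_inv_apply (fun a b => ?_) _ _)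
  simp only [Matrix.mul_apply, Matrix.conjTranspose_apply]
  exact Finset.measurable_sum _ fun m' _ =>
    (Complex.continuous_conj.measurable.comp (hZ m' a)).mul (hZ m' b)

lemma measurable_vecNormSq : Measurable (vecNormSq : (Fin M → ℂ) → ℝ) := by
  unfold vecNormSq
  fun_prop

lemma measurableSet_linearIndependent {ι : Type*} [Fintype ι] {v : α → ι → Fin M → ℂ}
    (hv : Measurable v) :
    MeasurableSet {x | LinearIndependent ℂ (v x)} :=
  hv isOpen_setOfPred_linearIndependent.measurableSet

end Measurability

/-! ### Zero forcing for Gaussian matrices. -/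

section Gaussian

variable {M : ℕ} {κ : Type*} [Fintype κ] [DecidableEq κ] {Ω : Type*} [MeasurableSpace Ω]
  {P : Measure Ω}

lemma hasLaw_mulVec_gaussianVector {n : ℕ} {B : Matrix (Fin n) (Fin M) ℂ} (hB : B * Bᴴ = 1)
    {u : ℝ≥0} {z : Ω → Fin M → ℂ} (hz : HasLaw z (gaussianVector fun _ => u) P) :
    HasLaw (fun ω => B *ᵥ z ω) (gaussianVector fun _ => u) P := by
  refine hasLaw_gaussianVector_linear hz (fun _ => u) (fun r j => B r j) fun r r' => ?_
  have h := congrFun (congrFun hB r) r'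
  rw [Matrix.mul_apply, Matrix.one_apply] at h
  calc ∑ j, B r j * ((u : ℝ) : ℂ) * conj (B r' j)
      = (∑ j, B r j * conj (B r' j)) * ((u : ℝ) : ℂ) := by
        rw [Finset.sum_mul]
        exact Finset.sum_congr rfl fun j _ => by ring
    _ = (if r = r' then 1 else 0) * ((u : ℝ) : ℂ) := congrArg (· * _) h
    _ = _ := by split_ifs <;> simp

/-- The coordinates of `z` in the orthogonal complement of the span of `W` are Gaussian of positive
variance. There is at least one of them, since `W` has fewer than `M` members, and it would vanish
if `z` were in the span. -/
lemma ae_linearIndependent_option {ι : Type*} [Fintype ι] [DecidableEq ι]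
    {W : ι → Fin M → ℂ} (hW : LinearIndependent ℂ W) (hcard : Fintype.card ι < M) {u : ℝ≥0}
    (hu : u ≠ 0) :
    ∀ᵐ z ∂gaussianVector (fun _ : Fin M => u),
      LinearIndependent ℂ (fun o : Option ι => o.elim z W) := by
  obtain ⟨n, hn⟩ : ∃ n, Fintype.card ι + (n + 1) = M := ⟨M - Fintype.card ι - 1, by omega⟩
  obtain ⟨B, hB1, hB0, -⟩ := exists_orthonormal_complement W hW hn
  have hlaw := hasLaw_mulVec_gaussianVector hB1 (HasLaw.id (μ := gaussianVector fun _ => u))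
  filter_upwards [ae_ne_zero_gaussianVector hlaw (i := 0) hu] with z hz
  refine linearIndependent_option.mpr ⟨hW, fun hmem => hz ?_⟩
  have : ∀ x ∈ Submodule.span ℂ (Set.range W), B *ᵥ x = 0 := by
    intro x hx
    induction hx using Submodule.span_induction with
    | mem x hx => obtain ⟨j, rfl⟩ := hx; exact hB0 j
    | zero => simp
    | add x y _ _ hx hy => rw [Matrix.mulVec_add, hx, hy, add_zero]
    | smul a x _ hx => rw [Matrix.mulVec_smul, hx, smul_zero]
  exact congrFun (this z hmem) 0

/-- At most `M` Gaussian columns of height `M` are almost surely linearly independent. -/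
lemma ae_linearIndependent_col {u : κ → ℝ≥0} (hu : ∀ j, u j ≠ 0) (hM : Fintype.card κ ≤ M)
    {Z : Ω → Matrix (Fin M) κ ℂ}
    (hZ : HasLaw (fun ω (x : κ × Fin M) => Z ω x.2 x.1) (gaussianVector fun x => u x.1) P) :
    ∀ᵐ ω ∂P, LinearIndependent ℂ (Z ω).col := by
  -- Columns are added one at a time: a new column is independent of the earlier ones, so these can
  -- be frozen by Fubini.
  have key : ∀ s : Finset κ, ∀ᵐ ω ∂P, LinearIndepOn ℂ (Z ω).col (s : Set κ) := by
    intro s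
    induction s using Finset.induction with
    | empty => simp
    | insert i s his ih =>
      have hcard : Fintype.card s < M := by
        rw [Fintype.card_coe]
        exact (Finset.card_lt_univ_of_notMem his).trans_le hM
      have hpair := hasLaw_gaussianVector_prod hZ (e := fun x : s × Fin M => ((x.1 : κ), x.2))
        (f := fun m : Fin M => (i, m)) (by
          rintro (⟨j, m⟩ | m) (⟨j', m'⟩ | m') h
          · simp only [Sum.elim_inl, Prod.mk.injEq] at h
            simp [Subtype.ext h.1, h.2]
          · simp only [Sum.elim_inl, Sum.elim_inr, Prod.mk.injEq] at h
            exact absurd (h.1 ▸ j.2) his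
          · simp only [Sum.elim_inl, Sum.elim_inr, Prod.mk.injEq] at h
            exact absurd (h.1 ▸ j'.2) his
          · simp only [Sum.elim_inr, Prod.mk.injEq] at h
            simp [h.2])
      have hW := hasLaw_gaussianVector_comp hZ (e := fun x : s × Fin M => ((x.1 : κ), x.2))
        (by
          rintro ⟨j, m⟩ ⟨j', m'⟩ h
          simp only [Prod.mk.injEq] at h
          simp [Subtype.ext h.1, h.2])
      have hms : MeasurableSet {W : s × Fin M → ℂ | LinearIndependent ℂ fun j m => W (j, m)} :=
        measurableSet_linearIndependent (by fun_prop)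
      have hmp : MeasurableSet {p : (s × Fin M → ℂ) × (Fin M → ℂ) | LinearIndependent ℂ
          fun o : Option s => o.elim p.2 fun j m => p.1 (j, m)} :=
        measurableSet_linearIndependent (measurable_pi_lambda _ fun o => by
          rcases o with _ | j
          · exact measurable_snd
          · exact measurable_pi_lambda _ fun m => (measurable_pi_apply _).comp measurable_fst)
      have hWae : ∀ᵐ W ∂gaussianVector (fun x : s × Fin M => u x.1),
          LinearIndependent ℂ fun j m => W (j, m) :=
        (hW.ae_iff (measurableSet_setOfPred.1 hms)).mp ih
      have hprod : ∀ᵐ p ∂(gaussianVector (fun x : s × Fin M => u x.1)).prod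
          (gaussianVector fun _ : Fin M => u i), LinearIndependent ℂ
          fun o : Option s => o.elim p.2 fun j m => p.1 (j, m) := by
        rw [Measure.ae_prod_iff_ae_ae hmp]
        filter_upwards [hWae] with W hWi
        exact ae_linearIndependent_option hWi hcard (hu i)
      filter_upwards [(hpair.ae_iff (measurableSet_setOfPred.1 hmp)).mpr hprod] with ω hω
      have h := linearIndependent_option.mp hω
      rw [Finset.coe_insert, linearIndepOn_insert (by simpa using his)]
      refine ⟨h.1, ?_⟩
      rw [Set.image_eq_range]
      exact h.2
  filter_upwards [key Finset.univ] with ω hω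
  rw [Finset.coe_univ, linearIndepOn_univ_iff] at hω
  exact hω

/-- The mean squared norm of a zero-forcing vector of a Gaussian matrix. -/
lemma lintegral_vecNormSq_zfVec {u : κ → ℝ≥0} (hu : ∀ j, u j ≠ 0) (hM : Fintype.card κ < M)
    {Z : Ω → Matrix (Fin M) κ ℂ}
    (hZ : HasLaw (fun ω (x : κ × Fin M) => Z ω x.2 x.1) (gaussianVector fun x => u x.1) P) (i : κ) :
    ∫⁻ ω, ENNReal.ofReal (vecNormSq (zfVec (Z ω) i)) ∂P =
      ENNReal.ofReal ((u i * ((M : ℝ) - Fintype.card κ))⁻¹) := by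
  have := hZ.isProbabilityMeasure
  -- `F` rebuilds the matrix from the columns other than `i` and from column `i`, two independent
  -- pieces; the mean is then taken over column `i` with the others fixed.
  let κ' := {j : κ // j ≠ i}
  let F : (κ' × Fin M → ℂ) × (Fin M → ℂ) → Matrix (Fin M) κ ℂ := fun p =>
    Matrix.of fun m j => if h : j = i then p.2 m else p.1 (⟨j, h⟩, m)
  have hF : ∀ m j, Measurable fun p => F p m j := by
    intro m j
    simp only [F, Matrix.of_apply]
    split_ifs <;> fun_prop
  have hpair := hasLaw_gaussianVector_prod hZ (e := fun x : κ' × Fin M => ((x.1 : κ), x.2))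
    (f := fun m : Fin M => (i, m)) (by
      rintro (⟨j, m⟩ | m) (⟨j', m'⟩ | m') h
      · simp only [Sum.elim_inl, Prod.mk.injEq] at h
        simp [Subtype.ext h.1, h.2]
      · simp only [Sum.elim_inl, Sum.elim_inr, Prod.mk.injEq] at h
        exact absurd h.1 j.2
      · simp only [Sum.elim_inl, Sum.elim_inr, Prod.mk.injEq] at h
        exact absurd h.1.symm j'.2
      · simp only [Sum.elim_inr, Prod.mk.injEq] at h
        simp [h.2])
  have hFZ : ∀ ω, F ((fun x => Z ω x.2 x.1), fun m => Z ω m i) = Z ω := by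
    intro ω
    ext m j
    by_cases h : j = i
    · simp [F, h]
    · simp [F, h]
  have hmp : MeasurableSet {p | LinearIndependent ℂ (F p).col} :=
    measurableSet_linearIndependent (measurable_pi_lambda _ fun j => measurable_pi_lambda _ fun m =>
      hF m j)
  have hind : ∀ᵐ ω ∂P, LinearIndependent ℂ
      (F ((fun x => Z ω x.2 x.1), fun m => Z ω m i)).col := by
    simpa only [hFZ] using ae_linearIndependent_col hu hM.le hZ
  have hprod := (hpair.ae_iff (measurableSet_setOfPred.1 hmp)).mp hind
  have hmeas : Measurable fun p => ENNReal.ofReal (vecNormSq (zfVec (F p) i)) :=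
    (measurable_vecNormSq.comp (measurable_zfVec hF i)).ennreal_ofReal
  have hcomp := hpair.lintegral_comp hmeas.aemeasurable
  simp only [hFZ] at hcomp
  rw [hcomp, lintegral_prod _ hmeas.aemeasurable]
  obtain ⟨n, hn⟩ : ∃ n, M = Fintype.card κ + (n + 1) := ⟨M - Fintype.card κ - 1, by omega⟩
  -- Only the other columns are projected out, one fewer than `Fintype.card κ`; hence the complement
  -- has dimension `n + 2`, as the mean of an inverse squared norm requires.
  have hcard : Fintype.card κ' + (n + 2) = M := by
    have h1 : Fintype.card κ' = Fintype.card κ - 1 := by simp [κ']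
    have h2 : 0 < Fintype.card κ := Fintype.card_pos_iff.mpr ⟨i⟩
    omega
  have hval : (M : ℝ) - Fintype.card κ = n + 1 := by
    rw [hn]
    push_cast
    ring
  rw [hval]
  have hinner : ∀ᵐ W ∂gaussianVector (fun x : κ' × Fin M => u x.1),
      ∫⁻ z, ENNReal.ofReal (vecNormSq (zfVec (F (W, z)) i)) ∂gaussianVector (fun _ => u i) =
        ENNReal.ofReal ((u i * ((n : ℝ) + 1))⁻¹) := by
    filter_upwards [Measure.ae_ae_of_ae_prod hprod] with W hW
    -- One completion of `W` to an independent family suffices to show that `W` itself is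
    -- independent.
    obtain ⟨z₀, hz₀⟩ := hW.exists
    have hcol : ∀ z (j : κ'), (F (W, z)).col j = fun m => W (j, m) := by
      intro z j
      ext m
      simp [F, j.2]
    have hcoli : ∀ z, (F (W, z)).col i = z := by
      intro z
      ext m
      simp [F]
    have hWind : LinearIndependent ℂ fun (j : κ') m => W (j, m) := by
      have := hz₀.comp (fun j : κ' => (j : κ)) Subtype.val_injective
      convert! this using 1
      ext j m
      simp [F, j.2]
    obtain ⟨B, hB1, hB0, hBB⟩ := exists_orthonormal_complement _ hWind hcard
    have hlaw := hasLaw_mulVec_gaussianVector hB1 (HasLaw.id (μ := gaussianVector fun _ => u i))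
    rw [← lintegral_inv_sum_norm_sq_gaussianVector hlaw (hu i) (Fintype.card_fin _)]
    refine lintegral_congr_ae ?_
    filter_upwards [hW] with z hz
    have h := vecNormSq_zfVec hz i (B := B)
      (fun j hj => by rw [hcol z ⟨j, hj⟩]; exact hB0 ⟨j, hj⟩)
      (fun v hv => hBB v fun j => by rw [← hcol z j]; exact hv j j.2)
    rw [hcoli] at h
    rw [h]
    rfl
  rw [lintegral_congr_ae hinner]
  simp

lemma measurable_zfVec_of (i : κ) :
    Measurable fun x : κ × Fin M → ℂ => zfVec (Matrix.of fun m j => x (j, m)) i := by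
  apply measurable_zfVec
  intro m j
  simp only [Matrix.of_apply]
  fun_prop

lemma aemeasurable_zfVec {Z : Ω → Matrix (Fin M) κ ℂ}
    (hZ : AEMeasurable (fun ω (x : κ × Fin M) => Z ω x.2 x.1) P) (i : κ) :
    AEMeasurable (fun ω => zfVec (Z ω) i) P := by
  have hof : ∀ ω, (Matrix.of fun m j => Z ω m j) = Z ω := fun _ => rfl
  have h := (measurable_zfVec_of i).comp_aemeasurable hZ
  simp only [Function.comp_def, hof] at h
  exact h

lemma integrable_vecNormSq_zfVec {u : κ → ℝ≥0} (hu : ∀ j, u j ≠ 0) (hM : Fintype.card κ < M)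
    {Z : Ω → Matrix (Fin M) κ ℂ}
    (hZ : HasLaw (fun ω (x : κ × Fin M) => Z ω x.2 x.1) (gaussianVector fun x => u x.1) P) (i : κ) :
    Integrable (fun ω => vecNormSq (zfVec (Z ω) i)) P ∧
    ∫ ω, vecNormSq (zfVec (Z ω) i) ∂P = (u i * ((M : ℝ) - Fintype.card κ))⁻¹ := by
  have h := lintegral_vecNormSq_zfVec hu hM hZ i
  have hmeas : AEStronglyMeasurable (fun ω => vecNormSq (zfVec (Z ω) i)) P :=
    (measurable_vecNormSq.comp_aemeasurable
      (aemeasurable_zfVec hZ.aemeasurable i)).aestronglyMeasurable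
  have hM' : (0 : ℝ) ≤ (M : ℝ) - Fintype.card κ := by
    rw [sub_nonneg]
    exact_mod_cast hM.le
  have hint : Integrable (fun ω => vecNormSq (zfVec (Z ω) i)) P := by
    refine ⟨hmeas, ?_⟩
    rw [hasFiniteIntegral_iff_ofReal (ae_of_all _ fun ω => vecNormSq_nonneg _), h]
    exact ENNReal.ofReal_lt_top
  refine ⟨hint, ?_⟩
  rw [integral_eq_lintegral_of_nonneg_ae (ae_of_all _ fun ω => vecNormSq_nonneg _) hmeas, h,
    ENNReal.toReal_ofReal (inv_nonneg.mpr (mul_nonneg (u i).coe_nonneg hM'))]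

end Gaussian

/-! ### The channel estimate: columns of `Hbar` and estimation errors. -/

namespace System

variable {L K τ M : ℕ} (s : System L K τ)

/-- The variance of the entries of the column of `Y_l Φ` that belongs to a pilot. -/
def columnVariance (l : Fin L) (r : Fin τ) : ℝ≥0 :=
  τ * (τ * ∑ t with s.pilot t = r, s.p t * s.β l t + 1)

/-- The variance of the entries of the channel estimation error. -/
def errorVariance (l : Fin L) (k : Fin K) : ℝ≥0 := Real.toNNReal (s.β l k - s.γ l k)

lemma columnVariance_ne_zero (l : Fin L) (r : Fin τ) : s.columnVariance l r ≠ 0 := by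
  have : (τ : ℝ≥0) ≠ 0 := Nat.cast_ne_zero.mpr (Nat.ne_of_gt r.pos)
  exact mul_ne_zero this (by positivity)

lemma coe_columnVariance (l : Fin L) (k : Fin K) : (s.columnVariance l (s.pilot k) : ℝ) =
    τ * (τ * ∑ t ∈ s.coPilot k, (s.p t : ℝ) * s.β l t + 1) := by
  simp [columnVariance, coPilot]

lemma denominator_pos (l : Fin L) (k : Fin K) :
    0 < (τ : ℝ) * ∑ t ∈ s.coPilot k, (s.p t : ℝ) * s.β l t + 1 := by positivity

/-- The normal equation of linear MMSE estimation: the right side is the covariance of a channel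
entry with the matching entry of its column. -/
lemma c_mul_columnVariance (l : Fin L) (k : Fin K) :
    s.c l k * s.columnVariance l (s.pilot k) = τ * √(s.p k : ℝ) * s.β l k := by
  have := (s.denominator_pos l k).ne'
  rw [coe_columnVariance, c]
  field_simp

lemma c_sq_mul_columnVariance (l : Fin L) (k : Fin K) :
    s.c l k ^ 2 * s.columnVariance l (s.pilot k) = s.γ l k := by
  have := (s.denominator_pos l k).ne'
  rw [sq, mul_assoc, c_mul_columnVariance, c, γ]
  have h := Real.sq_sqrt (s.p k).coe_nonneg
  field_simp
  rw [h]
  ring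

lemma c_nonneg (l : Fin L) (k : Fin K) : 0 ≤ s.c l k := by
  rw [c]
  positivity

lemma γ_nonneg (l : Fin L) (k : Fin K) : 0 ≤ s.γ l k := by
  rw [γ]
  positivity

lemma c_mul_sqrt_columnVariance (l : Fin L) (k : Fin K) :
    s.c l k * √(s.columnVariance l (s.pilot k) : ℝ) = √(s.γ l k) := by
  rw [← c_sq_mul_columnVariance, Real.sqrt_mul (sq_nonneg _), Real.sqrt_sq (s.c_nonneg l k)]

/-- The covariance of a channel entry with its estimate, in the form in which it enters the error
variance. -/
lemma γ_eq (l : Fin L) (k : Fin K) :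
    s.γ l k = s.β l k * (s.c l k * (τ * √(s.p k : ℝ))) := by
  have := (s.denominator_pos l k).ne'
  rw [c, γ]
  have h := Real.sq_sqrt (s.p k).coe_nonneg
  field_simp
  rw [h]
  ring

/-- The term of UE `k` itself is part of the denominator of `γ`. This makes the truncation in
`errorVariance` harmless. -/
lemma γ_le_β (l : Fin L) (k : Fin K) : s.γ l k ≤ s.β l k := by
  rw [γ, div_le_iff₀ (s.denominator_pos l k)]
  have h : (s.p k : ℝ) * s.β l k ≤ ∑ t ∈ s.coPilot k, (s.p t : ℝ) * s.β l t :=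
    Finset.single_le_sum (f := fun t => (s.p t : ℝ) * s.β l t) (fun i _ => by positivity)
      (by simp [coPilot])
  have h2 : (τ : ℝ) * s.β l k * ((s.p k : ℝ) * s.β l k) ≤
      τ * s.β l k * ∑ t ∈ s.coPilot k, (s.p t : ℝ) * s.β l t := by gcongr
  have h3 : (0 : ℝ) ≤ s.β l k := (s.β l k).coe_nonneg
  nlinarith

lemma coe_errorVariance (l : Fin L) (k : Fin K) :
    (s.errorVariance l k : ℝ) = s.β l k - s.γ l k :=
  Real.coe_toNNReal _ (sub_nonneg.mpr (s.γ_le_β l k))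

/-- The coefficients of a column of `Y_l Φ` in the channels and the noise. -/
def columnCoeff (r : Fin τ) : Fin K ⊕ Fin τ → ℂ :=
  Sum.elim (fun t => if s.pilot t = r then (τ : ℂ) * ((√(s.p t : ℝ) : ℝ) : ℂ) else 0)
    fun j => s.Φ j r

/-- The variances of the channels and of the noise at an AP. -/
def sourceVariance (l : Fin L) : Fin K ⊕ Fin τ → ℝ≥0 := Sum.elim (s.β l) fun _ => 1

/-- The coefficients of the columns of `Y_l Φ` and of the error of the channel estimate in the
channels and the noise. -/
def jointCoeff (l : Fin L) (k : Fin K) : Option (Fin τ) → Fin K ⊕ Fin τ → ℂ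
  | none => fun y => (if y = Sum.inl k then 1 else 0) - s.c l k * s.columnCoeff (s.pilot k) y
  | some r => s.columnCoeff r

/-- The variances of the entries of the columns of `Y_l Φ` and of the channel estimation error. -/
def jointVariance (l : Fin L) (k : Fin K) : Option (Fin τ) → ℝ≥0
  | none => s.errorVariance l k
  | some r => s.columnVariance l r

variable {s}

/-- Each UE on pilot `r` contributes `τ ^ 2 * p * β` and the noise contributes the squared norm `τ`
of the pilot. Different pilots involve disjoint sets of UEs and orthogonal combinations of the
noise. -/
lemma sum_columnCoeff (hpilots : s.OrthogonalPilots) (l : Fin L) (r r' : Fin τ) :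
    ∑ y, s.columnCoeff r y * ((s.sourceVariance l y : ℝ) : ℂ) * conj (s.columnCoeff r' y) =
      if r = r' then ((s.columnVariance l r : ℝ) : ℂ) else 0 := by
  have hΦ : ∑ j, s.Φ j r * conj (s.Φ j r') = if r = r' then (τ : ℂ) else 0 := by
    rw [← if_congr (eq_comm (a := r') (b := r)) rfl rfl, ← hpilots r' r]
    exact Finset.sum_congr rfl fun j _ => mul_comm _ _
  rw [Fintype.sum_sum_type]
  simp only [columnCoeff, sourceVariance, Sum.elim_inl, Sum.elim_inr, NNReal.coe_one,
    Complex.ofReal_one, mul_one, hΦ]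
  split_ifs with h
  · subst h
    have ht : ∀ t, (if s.pilot t = r then (τ : ℂ) * ((√(s.p t : ℝ) : ℝ) : ℂ) else 0) *
        ((s.β l t : ℝ) : ℂ) *
        conj (if s.pilot t = r then (τ : ℂ) * ((√(s.p t : ℝ) : ℝ) : ℂ) else 0) =
        (τ : ℂ) ^ 2 * if s.pilot t = r then ((s.p t : ℝ) : ℂ) * ((s.β l t : ℝ) : ℂ) else 0 := by
      intro t
      split_ifs
      · have h := congrArg (fun x : ℝ => (x : ℂ)) (Real.mul_self_sqrt (s.p t).coe_nonneg)
        simp only [Complex.ofReal_mul] at h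
        simp only [map_mul, Complex.conj_natCast, Complex.conj_ofReal]
        rw [← h]
        ring
      · simp
    simp_rw [ht]
    rw [← Finset.mul_sum, ← Finset.sum_filter, columnVariance]
    push_cast
    ring
  · rw [add_zero]
    refine Finset.sum_eq_zero fun t _ => ?_
    by_cases h1 : s.pilot t = r
    · rw [if_neg (fun h2 : s.pilot t = r' => h (h1.symm.trans h2))]
      simp
    · simp [h1]

/-- The error is orthogonal to its own column by the normal equation, and to the others because they
do not contain UE `k`. Hence its variance equals its covariance with the channel, which is `β - γ`.
-/
lemma sum_jointCoeff (hpilots : s.OrthogonalPilots) (l : Fin L) (k : Fin K)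
    (x x' : Option (Fin τ)) :
    ∑ y, s.jointCoeff l k x y * ((s.sourceVariance l y : ℝ) : ℂ) * conj (s.jointCoeff l k x' y) =
      if x = x' then ((s.jointVariance l k x : ℝ) : ℂ) else 0 := by
  have hk : ∀ r, s.columnCoeff r (Sum.inl k) =
      if s.pilot k = r then (τ : ℂ) * ((√(s.p k : ℝ) : ℝ) : ℂ) else 0 := fun _ => rfl
  have hv : s.sourceVariance l (Sum.inl k) = s.β l k := rfl
  have hcv := congrArg (fun x : ℝ => (x : ℂ)) (s.c_mul_columnVariance l k)
  simp only [Complex.ofReal_mul, Complex.ofReal_natCast] at hcv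
  have hnone : ∀ r, ∑ y, s.jointCoeff l k none y * ((s.sourceVariance l y : ℝ) : ℂ) *
      conj (s.columnCoeff r y) = 0 := by
    intro r
    simp only [jointCoeff, sub_mul, Finset.sum_sub_distrib]
    simp_rw [mul_assoc (s.c l k : ℂ)]
    rw [← Finset.mul_sum, sum_columnCoeff hpilots]
    simp only [ite_mul, one_mul, zero_mul, Finset.sum_ite_eq', Finset.mem_univ, if_true, hk, hv]
    split_ifs with h
    · simp only [map_mul, Complex.conj_natCast, Complex.conj_ofReal, hcv]
      ring
    · simp
  rcases x with _ | r <;> rcases x' with _ | r'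
  · rw [if_pos rfl]
    have h1 : ∀ y, s.jointCoeff l k none y * ((s.sourceVariance l y : ℝ) : ℂ) *
        conj (s.jointCoeff l k none y) =
        (if y = Sum.inl k then
          s.jointCoeff l k none y * ((s.sourceVariance l y : ℝ) : ℂ) else 0) -
        s.c l k * (s.jointCoeff l k none y * ((s.sourceVariance l y : ℝ) : ℂ) *
          conj (s.columnCoeff (s.pilot k) y)) := by
      intro y
      conv_lhs => rw [show conj (s.jointCoeff l k none y) = (if y = Sum.inl k then 1 else 0) -
        s.c l k * conj (s.columnCoeff (s.pilot k) y) by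
          simp only [jointCoeff, map_sub, map_mul, Complex.conj_ofReal]
          split_ifs <;> simp]
      split_ifs <;> ring
    simp_rw [h1]
    rw [Finset.sum_sub_distrib, ← Finset.mul_sum, hnone, mul_zero, sub_zero]
    simp only [Finset.sum_ite_eq', Finset.mem_univ, if_true, hv]
    simp only [jointCoeff, if_true, hk, jointVariance, coe_errorVariance, γ_eq]
    push_cast
    ring
  · rw [if_neg (by simp)]
    exact hnone r'
  · rw [if_neg (by simp)]
    have h := congrArg conj (hnone r)
    rw [map_zero, map_sum] at h
    rw [← h]
    refine Finset.sum_congr rfl fun y _ => ?_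
    simp only [map_mul, Complex.conj_conj, Complex.conj_ofReal, jointCoeff]
    ring
  · simp only [jointCoeff, jointVariance, Option.some.injEq]
    exact sum_columnCoeff hpilots l r r'

variable {Ω : Type*} [MeasurableSpace Ω] {P : Measure Ω}
  {h : Fin L → Fin K → Ω → Fin M → ℂ} {N : Fin L → Ω → Matrix (Fin M) (Fin τ) ℂ}

/-- The channels and the noise at an AP. -/
def source (h : Fin L → Fin K → Ω → Fin M → ℂ) (N : Fin L → Ω → Matrix (Fin M) (Fin τ) ℂ)
    (l : Fin L) (ω : Ω) (x : (Fin K ⊕ Fin τ) × Fin M) : ℂ :=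
  Sum.elim (fun t => h l t ω x.2) (fun j => N l ω x.2 j) x.1

/-- The place of the channels and the noise of an AP among those of all APs. -/
def sourceIndex (l : Fin L) (x : (Fin K ⊕ Fin τ) × Fin M) :
    (Fin L × Fin K × Fin M) ⊕ (Fin L × Fin M × Fin τ) :=
  Sum.elim (fun t => Sum.inl (l, t, x.2)) (fun j => Sum.inr (l, x.2, j)) x.1

lemma sourceIndex_inj {l l' : Fin L} {x x' : (Fin K ⊕ Fin τ) × Fin M} :
    sourceIndex l x = sourceIndex l' x' ↔ l = l' ∧ x = x' := by
  obtain ⟨y | y, m⟩ := x <;> obtain ⟨y' | y', m'⟩ := x' <;> simp [sourceIndex]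
  tauto

lemma hasLaw_allSources (hfading : s.RayleighFading P h N) :
    HasLaw (fun ω (i : (Fin L × Fin K × Fin M) ⊕ (Fin L × Fin M × Fin τ)) =>
      Sum.elim (fun x => h x.1 x.2.1 ω x.2.2) (fun y => N y.1 ω y.2.1 y.2.2) i)
      (gaussianVector (Sum.elim (fun x => s.β x.1 x.2.1) fun _ => 1)) P := by
  have h1 := hfading.indep.hasLaw_pi
    (μ := fun i => complexGaussian (Sum.elim (fun x => s.β x.1 x.2.1) (fun _ => 1) i)) (by
      rintro (⟨l, t, m⟩ | ⟨l, m, j⟩)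
      · exact hfading.channel_law l t m
      · exact hfading.noise_law l m j)
  convert! h1 using 1
  ext ω i
  rcases i with _ | _ <;> rfl

lemma hasLaw_source (hfading : s.RayleighFading P h N) (l : Fin L) :
    HasLaw (source h N l) (gaussianVector fun x => s.sourceVariance l x.1) P := by
  have h1 := hasLaw_gaussianVector_comp (hasLaw_allSources hfading) (e := sourceIndex l)
    fun x y hxy => (sourceIndex_inj.mp hxy).2
  convert! h1 using 1
  · ext ω x
    obtain ⟨y | y, m⟩ := x <;> rfl
  · congr 1
    ext x
    obtain ⟨y | y, m⟩ := x <;> rfl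

lemma indepFun_source (hfading : s.RayleighFading P h N) {l l' : Fin L} (hl : l ≠ l') :
    IndepFun (source h N l) (source h N l') P := by
  have h1 := indepFun_gaussianVector (hasLaw_allSources hfading) (e := sourceIndex l)
    (f := sourceIndex l') (by
      rintro (x | x) (y | y) hxy
      · rw [(sourceIndex_inj.mp hxy).2]
      · exact absurd (sourceIndex_inj.mp hxy).1 hl
      · exact absurd (sourceIndex_inj.mp hxy).1.symm hl
      · rw [(sourceIndex_inj.mp hxy).2])
  convert! h1 using 1 <;>
  · ext ω x
    obtain ⟨y | y, m⟩ := x <;> rfl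

lemma Hbar_apply {Ω : Type*} {h : Fin L → Fin K → Ω → Fin M → ℂ}
    {N : Fin L → Ω → Matrix (Fin M) (Fin τ) ℂ} (hpilots : s.OrthogonalPilots) (l : Fin L) (ω : Ω)
    (m : Fin M) (r : Fin τ) :
    s.Hbar h N l ω m r = ∑ y, s.columnCoeff r y * source h N l ω (y, m) := by
  have hΦ : ∀ t, ∑ j, conj (s.Φ j (s.pilot t)) * s.Φ j r = if s.pilot t = r then (τ : ℂ) else 0 :=
    fun t => hpilots (s.pilot t) r
  rw [Fintype.sum_sum_type]
  simp only [columnCoeff, source, Sum.elim_inl, Sum.elim_inr, Hbar, received, Matrix.mul_apply,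
    Matrix.add_apply, Matrix.sum_apply, Matrix.smul_apply, Matrix.vecMulVec_apply, Pi.star_apply,
    smul_eq_mul, add_mul, Finset.sum_add_distrib, Finset.sum_mul]
  congr 1
  · rw [Finset.sum_comm]
    refine Finset.sum_congr rfl fun t _ => ?_
    have h1 : ∀ j, ((√(s.p t : ℝ) : ℝ) : ℂ) * (h l t ω m * star (s.Φ.col (s.pilot t) j)) * s.Φ j r =
        ((√(s.p t : ℝ) : ℝ) : ℂ) * h l t ω m * (conj (s.Φ j (s.pilot t)) * s.Φ j r) := by
      intro j
      rw [← mul_assoc, mul_assoc]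
      rfl
    simp_rw [h1]
    rw [← Finset.mul_sum, hΦ]
    split_ifs <;> ring
  · exact Finset.sum_congr rfl fun j _ => mul_comm _ _

/-- The error of the linear MMSE channel estimate. -/
def estimationError (s : System L K τ) (h : Fin L → Fin K → Ω → Fin M → ℂ)
    (N : Fin L → Ω → Matrix (Fin M) (Fin τ) ℂ) (l : Fin L) (k : Fin K) (ω : Ω) : Fin M → ℂ :=
  h l k ω - (s.c l k : ℂ) • (s.Hbar h N l ω).col (s.pilot k)

/-- The columns of `Y_l Φ` together with the channel estimation error are independent Gaussians. -/
lemma hasLaw_joint (hfading : s.RayleighFading P h N) (hpilots : s.OrthogonalPilots) (l : Fin L)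
    (k : Fin K) :
    HasLaw (fun ω (x : Option (Fin τ) × Fin M) =>
      x.1.elim (s.estimationError h N l k ω x.2) fun r => s.Hbar h N l ω x.2 r)
      (gaussianVector fun x => s.jointVariance l k x.1) P := by
  have h1 := hasLaw_gaussianVector_linear (hasLaw_source hfading l)
    (fun x : Option (Fin τ) × Fin M => s.jointVariance l k x.1)
    (fun x y => if x.2 = y.2 then s.jointCoeff l k x.1 y.1 else 0) (by
      rintro ⟨x, m⟩ ⟨x', m'⟩
      rw [Fintype.sum_prod_type]
      have h2 : ∀ y : Fin K ⊕ Fin τ, ∑ m'' : Fin M,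
          (if m = m'' then s.jointCoeff l k x y else 0) * ((s.sourceVariance l y : ℝ) : ℂ) *
            conj (if m' = m'' then s.jointCoeff l k x' y else 0) =
          if m = m' then s.jointCoeff l k x y * ((s.sourceVariance l y : ℝ) : ℂ) *
            conj (s.jointCoeff l k x' y) else 0 := by
        intro y
        rw [Finset.sum_eq_single m (fun m'' _ hm => by simp [hm.symm]) (by simp)]
        by_cases hm : m = m'
        · simp [hm]
        · simp [hm, Ne.symm hm]
      simp_rw [h2]
      by_cases hm : m = m'
      · simpa [hm] using sum_jointCoeff hpilots l k x x'
      · simp [hm])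
  convert! h1 using 1
  ext ω ⟨x, m⟩
  rw [Fintype.sum_prod_type]
  simp only [ite_mul, zero_mul, Finset.sum_ite_eq, Finset.mem_univ, if_true]
  rcases x with _ | r
  · simp only [Option.elim, estimationError, Pi.sub_apply, Pi.smul_apply, Matrix.col_apply,
      smul_eq_mul, Hbar_apply hpilots, jointCoeff, sub_mul, Finset.sum_sub_distrib, ite_mul,
      one_mul, zero_mul, Finset.sum_ite_eq', Finset.mem_univ, if_true, mul_assoc, Finset.mul_sum]
    rfl
  · simp only [Option.elim, jointCoeff, Hbar_apply hpilots]

end System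

/-! ### Precoders: normalization, laws of the columns, measurability. -/

section Normalized

variable {M : ℕ} {Ω : Type*} [MeasurableSpace Ω] {P : Measure Ω} {v : Ω → Fin M → ℂ}

lemma vecNormSq_normalized (v : Ω → Fin M → ℂ) (ω : Ω) :
    vecNormSq (normalized P v ω) = (∫ ω', vecNormSq (v ω') ∂P)⁻¹ * vecNormSq (v ω) := by
  rw [normalized, vecNormSq_smul, Complex.norm_real, Real.norm_eq_abs, sq_abs, inv_pow,
    Real.sq_sqrt (integral_nonneg fun _ => vecNormSq_nonneg _)]

lemma integrable_vecNormSq_normalized (hv : Integrable (fun ω => vecNormSq (v ω)) P) :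
    Integrable (fun ω => vecNormSq (normalized P v ω)) P := by
  simp_rw [vecNormSq_normalized]
  exact hv.const_mul _

lemma integral_vecNormSq_normalized (hv : 0 < ∫ ω, vecNormSq (v ω) ∂P) :
    ∫ ω, vecNormSq (normalized P v ω) ∂P = 1 := by
  simp_rw [vecNormSq_normalized]
  rw [integral_const_mul, inv_mul_cancel₀ hv.ne']

end Normalized

namespace System

variable {L K τ M : ℕ} {s : System L K τ} {Ω : Type*} [MeasurableSpace Ω] {P : Measure Ω}
  {h : Fin L → Fin K → Ω → Fin M → ℂ} {N : Fin L → Ω → Matrix (Fin M) (Fin τ) ℂ}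

/-- The entries of `Y_l Φ`, column by column. -/
def columns (s : System L K τ) (h : Fin L → Fin K → Ω → Fin M → ℂ)
    (N : Fin L → Ω → Matrix (Fin M) (Fin τ) ℂ) (l : Fin L) (ω : Ω) (x : Fin τ × Fin M) : ℂ :=
  s.Hbar h N l ω x.2 x.1

lemma hasLaw_columns (hfading : s.RayleighFading P h N) (hpilots : s.OrthogonalPilots) (l : Fin L)
    (k : Fin K) :
    HasLaw (s.columns h N l) (gaussianVector fun x => s.columnVariance l x.1) P :=
  hasLaw_gaussianVector_comp (hasLaw_joint hfading hpilots l k)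
    (e := fun x : Fin τ × Fin M => (some x.1, x.2)) fun x y hxy => by
      simp only [Prod.mk.injEq, Option.some.injEq] at hxy
      exact Prod.ext hxy.1 hxy.2

lemma hasLaw_estimationError (hfading : s.RayleighFading P h N) (hpilots : s.OrthogonalPilots)
    (l : Fin L) (k : Fin K) :
    HasLaw (s.estimationError h N l k) (gaussianVector fun _ => s.errorVariance l k) P :=
  hasLaw_gaussianVector_comp (hasLaw_joint hfading hpilots l k)
    (e := fun m : Fin M => (none, m)) fun _ _ hxy => (Prod.mk.injEq _ _ _ _ ▸ hxy).2

lemma indepFun_columns_estimationError (hfading : s.RayleighFading P h N)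
    (hpilots : s.OrthogonalPilots) (l : Fin L) (k : Fin K) :
    IndepFun (s.columns h N l) (s.estimationError h N l k) P :=
  indepFun_gaussianVector (hasLaw_joint hfading hpilots l k)
    (e := fun x : Fin τ × Fin M => (some x.1, x.2)) (f := fun m : Fin M => (none, m)) (by
      rintro (x | m) (x' | m') hxy
      · simp only [Sum.elim_inl, Prod.mk.injEq, Option.some.injEq] at hxy
        rw [Prod.ext hxy.1 hxy.2]
      · simp at hxy
      · simp at hxy
      · simp only [Sum.elim_inr, Prod.mk.injEq] at hxy
        rw [hxy.2])

lemma hasLaw_column (hfading : s.RayleighFading P h N) (hpilots : s.OrthogonalPilots) (l : Fin L)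
    (k : Fin K) :
    HasLaw (fun ω => (s.Hbar h N l ω).col (s.pilot k))
      (gaussianVector fun _ => s.columnVariance l (s.pilot k)) P :=
  hasLaw_gaussianVector_comp (hasLaw_columns hfading hpilots l k)
    (e := fun m : Fin M => (s.pilot k, m)) fun _ _ hxy => (Prod.mk.injEq _ _ _ _ ▸ hxy).2

/-- The columns of `Y_l Φ` that belong to the pilots of the strong UEs. -/
def strongColumns (s : System L K τ) (h : Fin L → Fin K → Ω → Fin M → ℂ)
    (N : Fin L → Ω → Matrix (Fin M) (Fin τ) ℂ) (l : Fin L) (ω : Ω) :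
    Matrix (Fin M) (s.strongPilots l) ℂ :=
  Matrix.of fun m r => s.columns h N l ω (r, m)

lemma pilot_mem_strongPilots {l : Fin L} {k : Fin K} (hk : k ∈ s.strong l) :
    s.pilot k ∈ s.strongPilots l :=
  Finset.mem_image_of_mem _ hk

/-- Common grouping keeps a weak UE from sharing a pilot with a strong one, so the columns of weak
UEs stay outside the zero-forcing matrix. -/
lemma pilot_mem_strongPilots_iff (hgroup : s.CoPilotGrouping) {l : Fin L} {k : Fin K} :
    s.pilot k ∈ s.strongPilots l ↔ k ∈ s.strong l := by
  refine ⟨fun hk => ?_, pilot_mem_strongPilots⟩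
  obtain ⟨t, ht, htk⟩ := Finset.mem_image.mp hk
  exact hgroup l t k htk.symm ht

lemma hasLaw_strongColumns (hfading : s.RayleighFading P h N) (hpilots : s.OrthogonalPilots)
    (l : Fin L) (k : Fin K) :
    HasLaw (fun ω (x : s.strongPilots l × Fin M) => s.strongColumns h N l ω x.2 x.1)
      (gaussianVector fun x => s.columnVariance l x.1) P :=
  hasLaw_gaussianVector_comp (hasLaw_columns hfading hpilots l k)
    (e := fun x : s.strongPilots l × Fin M => ((x.1 : Fin τ), x.2)) (by
      rintro ⟨j, m⟩ ⟨j', m'⟩ hxy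
      simp only [Prod.mk.injEq] at hxy
      simp [Subtype.ext hxy.1, hxy.2])

lemma zfDirection_eq {Ω : Type*} {h : Fin L → Fin K → Ω → Fin M → ℂ}
    {N : Fin L → Ω → Matrix (Fin M) (Fin τ) ℂ} {l : Fin L} {k : Fin K} (hk : k ∈ s.strong l)
    (ω : Ω) : s.zfDirection h N l k ω =
      zfVec (s.strongColumns h N l ω) ⟨s.pilot k, pilot_mem_strongPilots hk⟩ := by
  have h1 : s.Hbar h N l ω * s.selection l = s.strongColumns h N l ω := by
    ext m r
    simp [Matrix.mul_apply, selection, strongColumns, columns]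
  have h2 : s.basisVec l k = Pi.single ⟨s.pilot k, pilot_mem_strongPilots hk⟩ 1 := by
    ext r
    simp [basisVec, Pi.single_apply, Subtype.ext_iff]
  rw [zfDirection, zfVec, Matrix.mul_assoc _ (s.Hbar h N l ω), h1, ← Matrix.conjTranspose_mul, h1,
    h2]

lemma mrtDirection_eq {Ω : Type*} {h : Fin L → Fin K → Ω → Fin M → ℂ}
    {N : Fin L → Ω → Matrix (Fin M) (Fin τ) ℂ} (l : Fin L) (k : Fin K) (ω : Ω) :
    s.mrtDirection h N l k ω = (s.Hbar h N l ω).col (s.pilot k) := by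
  rw [mrtDirection, Matrix.mulVec_single_one]

lemma moments_zfDirection (hfading : s.RayleighFading P h N) (hpilots : s.OrthogonalPilots)
    {l : Fin L} (hM : s.tauS l < M) {k : Fin K} (hk : k ∈ s.strong l) :
    Integrable (fun ω => vecNormSq (s.zfDirection h N l k ω)) P ∧
    ∫ ω, vecNormSq (s.zfDirection h N l k ω) ∂P =
      (s.columnVariance l (s.pilot k) * ((M : ℝ) - s.tauS l))⁻¹ := by
  have hcard : Fintype.card (s.strongPilots l) = s.tauS l := Fintype.card_coe _
  have h1 := integrable_vecNormSq_zfVec (u := fun r : s.strongPilots l => s.columnVariance l r)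
    (fun r => s.columnVariance_ne_zero l r) (hcard.trans_lt hM)
    (hasLaw_strongColumns hfading hpilots l k) ⟨s.pilot k, pilot_mem_strongPilots hk⟩
  simp_rw [zfDirection_eq hk]
  rwa [hcard] at h1

lemma moments_mrtDirection (hfading : s.RayleighFading P h N) (hpilots : s.OrthogonalPilots)
    (l : Fin L) (k : Fin K) :
    Integrable (fun ω => vecNormSq (s.mrtDirection h N l k ω)) P ∧
    ∫ ω, vecNormSq (s.mrtDirection h N l k ω) ∂P = M * s.columnVariance l (s.pilot k) := by
  have hcol := hasLaw_column hfading hpilots l k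
  simp_rw [mrtDirection_eq]
  refine ⟨integrable_finsetSum _ fun m _ => by
    simpa using integrable_norm_pow_gaussianVector hcol m 1, ?_⟩
  simpa [vecNormSq] using integral_sum_norm_sq_gaussianVector hcol

lemma zfDirection_norm_pos {l : Fin L} (hM : s.tauS l < M) (r : Fin τ) :
    0 < (s.columnVariance l r : ℝ) * ((M : ℝ) - s.tauS l) := by
  have h1 : (0 : ℝ) < s.columnVariance l r := by
    exact_mod_cast pos_iff_ne_zero.mpr (s.columnVariance_ne_zero l r)
  have h2 : (s.tauS l : ℝ) < M := by exact_mod_cast hM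
  exact mul_pos h1 (sub_pos.mpr h2)

lemma mrtDirection_norm_pos {l : Fin L} (hM : s.tauS l < M) (r : Fin τ) :
    0 < (M : ℝ) * s.columnVariance l r := by
  have h1 : (0 : ℝ) < s.columnVariance l r := by
    exact_mod_cast pos_iff_ne_zero.mpr (s.columnVariance_ne_zero l r)
  have h2 : (0 : ℝ) < M := by exact_mod_cast (Nat.zero_le _).trans_lt hM
  exact mul_pos h2 h1

lemma moments_precoder (hfading : s.RayleighFading P h N) (hpilots : s.OrthogonalPilots)
    {l : Fin L} (hM : s.tauS l < M) (t : Fin K) :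
    Integrable (fun ω => vecNormSq (s.precoder P h N l t ω)) P ∧
    ∫ ω, vecNormSq (s.precoder P h N l t ω) ∂P = 1 := by
  by_cases ht : t ∈ s.strong l
  · have h1 := moments_zfDirection hfading hpilots hM ht
    simp only [precoder, if_pos ht, zf]
    refine ⟨integrable_vecNormSq_normalized h1.1, integral_vecNormSq_normalized ?_⟩
    rw [h1.2]
    exact inv_pos.mpr (zfDirection_norm_pos hM _)
  · have h1 := moments_mrtDirection hfading hpilots l t
    simp only [precoder, if_neg ht, mrt]
    refine ⟨integrable_vecNormSq_normalized h1.1, integral_vecNormSq_normalized ?_⟩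
    rw [h1.2]
    exact mrtDirection_norm_pos hM _

/-- The precoders are measurable functions of the received pilot signals. -/
lemma exists_measurable_precoder (s : System L K τ) (P : Measure Ω)
    (h : Fin L → Fin K → Ω → Fin M → ℂ) (N : Fin L → Ω → Matrix (Fin M) (Fin τ) ℂ)
    (l : Fin L) (t : Fin K) :
    ∃ w : (Fin τ × Fin M → ℂ) → Fin M → ℂ, Measurable w ∧
      ∀ ω, s.precoder P h N l t ω = w (s.columns h N l ω) := by
  by_cases ht : t ∈ s.strong l
  · refine ⟨fun x => (((√(∫ ω', vecNormSq (s.zfDirection h N l t ω') ∂P))⁻¹ : ℝ) : ℂ) •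
      zfVec (Matrix.of fun m (r : s.strongPilots l) => x (r, m))
        ⟨s.pilot t, pilot_mem_strongPilots ht⟩, ?_, fun ω => ?_⟩
    · have hz : Measurable fun x : Fin τ × Fin M → ℂ =>
          zfVec (Matrix.of fun m (r : s.strongPilots l) => x (r, m))
            ⟨s.pilot t, pilot_mem_strongPilots ht⟩ := by
        apply measurable_zfVec
        intro m j
        simp only [Matrix.of_apply]
        fun_prop
      fun_prop
    · simp only [precoder, if_pos ht, zf, normalized]
      rw [zfDirection_eq ht]
      rfl
  · refine ⟨fun x => (((√(∫ ω', vecNormSq (s.mrtDirection h N l t ω') ∂P))⁻¹ : ℝ) : ℂ) •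
      fun m => x (s.pilot t, m), by fun_prop, fun ω => ?_⟩
    simp only [precoder, if_neg ht, mrt, normalized]
    rw [mrtDirection_eq]
    rfl

/-! ### Moments of the effective channels at one AP. -/

/-- The gain that the estimated part of a channel contributes. -/
def estimateGain (s : System L K τ) (P : Measure Ω) (h : Fin L → Fin K → Ω → Fin M → ℂ)
    (N : Fin L → Ω → Matrix (Fin M) (Fin τ) ℂ) (l : Fin L) (k t : Fin K) (ω : Ω) : ℂ :=
  s.c l k * (star ((s.Hbar h N l ω).col (s.pilot k)) ⬝ᵥ s.precoder P h N l t ω)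

/-- Separates what the precoder depends on, the columns, from the error, which is independent of
them. -/
lemma gain_eq (l : Fin L) (k t : Fin K) (ω : Ω) :
    s.gain P h N l k t ω = s.estimateGain P h N l k t ω +
      star (s.estimationError h N l k ω) ⬝ᵥ s.precoder P h N l t ω := by
  have h1 : star (h l k ω) = (s.c l k : ℂ) • star ((s.Hbar h N l ω).col (s.pilot k)) +
      star (s.estimationError h N l k ω) := by
    ext m
    simp [estimationError]
  rw [gain, h1, add_dotProduct, smul_dotProduct, estimateGain, smul_eq_mul]

/-- The mean of the effective scalar channel. -/
def gainMean (s : System L K τ) (M : ℕ) (l : Fin L) (k t : Fin K) : ℝ :=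
  if s.pilot t = s.pilot k then √(((M : ℝ) - s.δ l t * s.tauS l) * s.γ l k) else 0

/-- Serves both MRT on another pilot and zero forcing seen by a weak UE: there the precoder is a
unit mean square vector independent of the column. -/
lemma moments_estimateGain_of_indepFun [IsProbabilityMeasure P] (hfading : s.RayleighFading P h N)
    (hpilots : s.OrthogonalPilots) {l : Fin L} (hM : s.tauS l < M) (k t : Fin K)
    (hind : IndepFun (s.precoder P h N l t) (fun ω => (s.Hbar h N l ω).col (s.pilot k)) P) :
    MemLp (s.estimateGain P h N l k t) 2 P ∧
    ∫ ω, s.estimateGain P h N l k t ω ∂P = 0 ∧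
    ∫ ω, ‖s.estimateGain P h N l k t ω‖ ^ 2 ∂P = s.γ l k := by
  obtain ⟨w, hw, hwe⟩ := exists_measurable_precoder s P h N l t
  have hprec : AEMeasurable (s.precoder P h N l t) P := by
    rw [funext hwe]
    exact hw.comp_aemeasurable (hasLaw_columns hfading hpilots l k).aemeasurable
  have hnorm := moments_precoder hfading hpilots hM t
  -- The precoder itself plays the role of `Y`, with no affine term.
  have h1 := moments_add_dotProduct_gaussianVector (hasLaw_column hfading hpilots l k)
    hprec hind (A := fun _ => 0) measurable_const (w := id) measurable_id (by simp) hnorm.1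
  simp only [zero_add, id, integral_zero, norm_zero, ne_eq, OfNat.ofNat_ne_zero,
    not_false_eq_true, zero_pow, hnorm.2, mul_one] at h1
  refine ⟨h1.1.const_mul _, ?_, ?_⟩
  · simp only [estimateGain]
    rw [integral_const_mul, h1.2.1, mul_zero]
  · simp only [estimateGain, norm_mul, mul_pow, Complex.norm_real, Real.norm_eq_abs, sq_abs]
    rw [integral_const_mul, h1.2.2, c_sq_mul_columnVariance]

lemma indepFun_normalized {𝓨 : Type*} [MeasurableSpace 𝓨] {v : Ω → Fin M → ℂ} {Y : Ω → 𝓨}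
    (hind : IndepFun v Y P) : IndepFun (normalized P v) Y P :=
  hind.comp (φ := fun x => (((√(∫ ω', vecNormSq (v ω') ∂P))⁻¹ : ℝ) : ℂ) • x) (ψ := id)
    (by fun_prop) measurable_id

lemma indepFun_zf_column (hfading : s.RayleighFading P h N) (hpilots : s.OrthogonalPilots)
    {l : Fin L} {k t : Fin K} (ht : t ∈ s.strong l) (hk : s.pilot k ∉ s.strongPilots l) :
    IndepFun (s.zf P h N l t) (fun ω => (s.Hbar h N l ω).col (s.pilot k)) P := by
  refine indepFun_normalized ?_
  have h1 := indepFun_gaussianVector (hasLaw_columns hfading hpilots l k)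
    (e := fun x : s.strongPilots l × Fin M => ((x.1 : Fin τ), x.2))
    (f := fun m : Fin M => (s.pilot k, m)) (by
      rintro (⟨j, m⟩ | m) (⟨j', m'⟩ | m') hxy
      · simp only [Sum.elim_inl, Prod.mk.injEq] at hxy
        simp [Subtype.ext hxy.1, hxy.2]
      · simp only [Sum.elim_inl, Sum.elim_inr, Prod.mk.injEq] at hxy
        exact absurd (hxy.1 ▸ j.2) hk
      · simp only [Sum.elim_inl, Sum.elim_inr, Prod.mk.injEq] at hxy
        exact absurd (hxy.1 ▸ j'.2) hk
      · simp only [Sum.elim_inr, Prod.mk.injEq] at hxy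
        simp [hxy.2])
  have h2 := h1.comp (measurable_zfVec_of ⟨s.pilot t, pilot_mem_strongPilots ht⟩) measurable_id
  rw [funext fun ω => zfDirection_eq (h := h) (N := N) ht ω]
  exact h2

lemma indepFun_mrt_column (hfading : s.RayleighFading P h N) (hpilots : s.OrthogonalPilots)
    (l : Fin L) {k t : Fin K} (hkt : s.pilot t ≠ s.pilot k) :
    IndepFun (s.mrt P h N l t) (fun ω => (s.Hbar h N l ω).col (s.pilot k)) P := by
  refine indepFun_normalized ?_
  have h1 := indepFun_gaussianVector (hasLaw_columns hfading hpilots l k)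
    (e := fun m : Fin M => (s.pilot t, m))
    (f := fun m : Fin M => (s.pilot k, m)) (by
      rintro (m | m) (m' | m') hxy
      · simp only [Sum.elim_inl, Prod.mk.injEq] at hxy
        simp [hxy.2]
      · simp only [Sum.elim_inl, Sum.elim_inr, Prod.mk.injEq] at hxy
        exact absurd hxy.1 hkt
      · simp only [Sum.elim_inl, Sum.elim_inr, Prod.mk.injEq] at hxy
        exact absurd hxy.1.symm hkt
      · simp only [Sum.elim_inr, Prod.mk.injEq] at hxy
        simp [hxy.2])
  rw [funext fun ω => mrtDirection_eq (s := s) (h := h) (N := N) l t ω]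
  exact h1

/-- Before normalization the inner product is exactly zero or one wherever the strong columns are
independent. The absence of fluctuation is what removes `γ` from the interference between strong
UEs. -/
lemma ae_estimateGain_zf [IsProbabilityMeasure P]
    (hfading : s.RayleighFading P h N) (hpilots : s.OrthogonalPilots)
    {l : Fin L} (hM : s.tauS l < M) {k t : Fin K} (ht : t ∈ s.strong l) (hk : k ∈ s.strong l) :
    ∀ᵐ ω ∂P, s.estimateGain P h N l k t ω = s.gainMean M l k t := by
  have hcard : Fintype.card (s.strongPilots l) = s.tauS l := Fintype.card_coe _
  filter_upwards [ae_linearIndependent_col (u := fun r : s.strongPilots l => s.columnVariance l r)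
    (fun r => s.columnVariance_ne_zero l r)
    (hcard.trans_lt hM).le (hasLaw_strongColumns hfading hpilots l k)] with ω hω
  have h1 := star_col_dotProduct_zfVec hω ⟨s.pilot t, pilot_mem_strongPilots ht⟩
    ⟨s.pilot k, pilot_mem_strongPilots hk⟩
  rw [← zfDirection_eq ht, show (s.strongColumns h N l ω).col ⟨s.pilot k, _⟩ =
    (s.Hbar h N l ω).col (s.pilot k) from rfl] at h1
  simp only [Subtype.mk.injEq] at h1
  simp only [estimateGain, precoder, if_pos ht, zf, normalized]
  rw [dotProduct_smul, h1, (moments_zfDirection hfading hpilots hM ht).2, gainMean]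
  by_cases hkt : s.pilot t = s.pilot k
  · rw [if_pos hkt, if_pos hkt.symm, smul_eq_mul, mul_one, ← Complex.ofReal_mul, hkt,
      Real.sqrt_inv, inv_inv, Real.sqrt_mul (NNReal.coe_nonneg _), ← mul_assoc,
      c_mul_sqrt_columnVariance, ← Real.sqrt_mul (s.γ_nonneg l k), δ, if_pos ht, one_mul, mul_comm]
  · rw [if_neg hkt, if_neg (Ne.symm hkt)]
    simp

lemma estimateGain_mrt (hfading : s.RayleighFading P h N) (hpilots : s.OrthogonalPilots)
    {l : Fin L} {k t : Fin K} (ht : t ∉ s.strong l) (hkt : s.pilot t = s.pilot k) (ω : Ω) :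
    s.estimateGain P h N l k t ω =
      ((s.c l k * (√(M * s.columnVariance l (s.pilot k) : ℝ))⁻¹ *
        ∑ m, ‖(s.Hbar h N l ω).col (s.pilot k) m‖ ^ 2 : ℝ) : ℂ) := by
  simp only [estimateGain, precoder, if_neg ht, mrt, normalized]
  rw [(moments_mrtDirection hfading hpilots l t).2, mrtDirection_eq, hkt, dotProduct_smul,
    ← ofReal_vecNormSq, vecNormSq]
  push_cast
  rw [smul_eq_mul, mul_assoc]

/-- The gain is a multiple of the squared norm of a Gaussian vector of length `M`, whose second
moment is proportional to `M * (M + 1)`: the squared mean accounts for `M` and the fluctuation for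
the extra one. -/
lemma moments_estimateGain_mrt [IsProbabilityMeasure P]
    (hfading : s.RayleighFading P h N) (hpilots : s.OrthogonalPilots)
    {l : Fin L} (hM : s.tauS l < M) {k t : Fin K} (ht : t ∉ s.strong l)
    (hkt : s.pilot t = s.pilot k) :
    MemLp (s.estimateGain P h N l k t) 2 P ∧
    ∫ ω, s.estimateGain P h N l k t ω ∂P = √(M * s.γ l k) ∧
    ∫ ω, ‖s.estimateGain P h N l k t ω‖ ^ 2 ∂P = (M + 1) * s.γ l k := by
  have hcol := hasLaw_column hfading hpilots l k
  have hpos := mrtDirection_norm_pos hM (s.pilot k)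
  have hMpos : (0 : ℝ) < M := pos_of_mul_pos_left hpos (NNReal.coe_nonneg _)
  have hv : (s.columnVariance l (s.pilot k) : ℝ) ≠ 0 := by
    exact_mod_cast s.columnVariance_ne_zero l _
  simp_rw [funext fun ω => estimateGain_mrt hfading hpilots ht hkt ω]
  have hsq : ∀ ω, ‖((s.c l k * (√(M * s.columnVariance l (s.pilot k) : ℝ))⁻¹ *
        ∑ m, ‖(s.Hbar h N l ω).col (s.pilot k) m‖ ^ 2 : ℝ) : ℂ)‖ ^ 2 =
      (s.c l k * (√(M * s.columnVariance l (s.pilot k) : ℝ))⁻¹) ^ 2 *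
        (∑ m, ‖(s.Hbar h N l ω).col (s.pilot k) m‖ ^ 2) ^ 2 := by
    intro ω
    rw [Complex.norm_real, Real.norm_eq_abs, sq_abs, mul_pow]
  refine ⟨?_, ?_, ?_⟩
  · have hm := hcol.aemeasurable
    have hm' : AEMeasurable (fun ω => ((s.c l k * (√(M * s.columnVariance l (s.pilot k) : ℝ))⁻¹ *
        ∑ m, ‖(s.Hbar h N l ω).col (s.pilot k) m‖ ^ 2 : ℝ) : ℂ)) P := by
      have hf : Measurable fun x : Fin M → ℂ =>
          ((s.c l k * (√(M * s.columnVariance l (s.pilot k) : ℝ))⁻¹ * ∑ m, ‖x m‖ ^ 2 : ℝ) : ℂ) := by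
        fun_prop
      exact hf.comp_aemeasurable hm
    rw [memLp_two_iff_integrable_sq_norm hm'.aestronglyMeasurable]
    simp_rw [hsq]
    exact (integrable_sum_norm_sq_sq_gaussianVector hcol).const_mul _
  · rw [integral_complex_ofReal, integral_const_mul, integral_sum_norm_sq_gaussianVector hcol,
      Fintype.card_fin]
    congr 1
    rw [mul_assoc, inv_mul_eq_div, Real.div_sqrt, Real.sqrt_mul hMpos.le, mul_left_comm,
      c_mul_sqrt_columnVariance, ← Real.sqrt_mul hMpos.le]
  · simp_rw [hsq]
    rw [integral_const_mul, integral_sum_norm_sq_sq_gaussianVector hcol, Fintype.card_fin,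
      ← c_sq_mul_columnVariance, mul_pow, inv_pow, Real.sq_sqrt hpos.le]
    field_simp

/-- The variance is `γ` in every case except when both UEs are strong. A strong `t` and a weak `k`
cannot share a pilot, by the grouping. -/
lemma moments_estimateGain [IsProbabilityMeasure P]
    (hfading : s.RayleighFading P h N) (hpilots : s.OrthogonalPilots)
    (hgroup : s.CoPilotGrouping) {l : Fin L} (hM : s.tauS l < M) (k t : Fin K) :
    MemLp (s.estimateGain P h N l k t) 2 P ∧
    ∫ ω, s.estimateGain P h N l k t ω ∂P = s.gainMean M l k t ∧
    ∫ ω, ‖s.estimateGain P h N l k t ω‖ ^ 2 ∂P =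
      s.gainMean M l k t ^ 2 + (1 - s.δ l t * s.δ l k) * s.γ l k := by
  by_cases ht : t ∈ s.strong l
  · by_cases hk : k ∈ s.strong l
    · have hae := ae_estimateGain_zf hfading hpilots hM ht hk
      refine ⟨(memLp_congr_ae hae).mpr (memLp_const _), ?_, ?_⟩
      · rw [integral_congr_ae hae]
        simp
      · have hae2 : (fun ω => ‖s.estimateGain P h N l k t ω‖ ^ 2) =ᵐ[P]
            fun _ => s.gainMean M l k t ^ 2 := by
          filter_upwards [hae] with ω hω
          rw [hω, Complex.norm_real, Real.norm_eq_abs, sq_abs]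
        rw [integral_congr_ae hae2]
        simp [δ, ht, hk]
    · have hkp : s.pilot k ∉ s.strongPilots l := fun hk' =>
        hk ((pilot_mem_strongPilots_iff hgroup).mp hk')
      have hkt : s.pilot t ≠ s.pilot k := fun hkt => hkp (hkt ▸ pilot_mem_strongPilots ht)
      have h1 := moments_estimateGain_of_indepFun hfading hpilots hM k t (by
        simp only [precoder, if_pos ht]
        exact indepFun_zf_column hfading hpilots ht hkp)
      simpa [gainMean, hkt, δ, hk] using h1
  · by_cases hkt : s.pilot t = s.pilot k
    · have h1 := moments_estimateGain_mrt hfading hpilots hM ht hkt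
      refine ⟨h1.1, ?_, ?_⟩
      · rw [h1.2.1]
        simp [gainMean, hkt, δ, ht]
      · rw [h1.2.2, gainMean, if_pos hkt, δ, if_neg ht, zero_mul, zero_mul, sub_zero,
          Real.sq_sqrt (mul_nonneg M.cast_nonneg (s.γ_nonneg l k))]
        ring
    · have h1 := moments_estimateGain_of_indepFun hfading hpilots hM k t (by
        simp only [precoder, if_neg ht]
        exact indepFun_mrt_column hfading hpilots l hkt)
      simpa [gainMean, hkt, δ, ht] using h1

/-- First and second moments of the effective scalar channels. -/
lemma moments_gain [IsProbabilityMeasure P]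
    (hfading : s.RayleighFading P h N) (hpilots : s.OrthogonalPilots)
    (hgroup : s.CoPilotGrouping) {l : Fin L} (hM : s.tauS l < M) (k t : Fin K) :
    MemLp (s.gain P h N l k t) 2 P ∧
    ∫ ω, s.gain P h N l k t ω ∂P = s.gainMean M l k t ∧
    ∫ ω, ‖s.gain P h N l k t ω‖ ^ 2 ∂P =
      s.gainMean M l k t ^ 2 + (s.β l k - s.δ l t * s.δ l k * s.γ l k) := by
  obtain ⟨w, hw, hwe⟩ := exists_measurable_precoder s P h N l t
  have hest := moments_estimateGain hfading hpilots hgroup hM k t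
  have hnorm := moments_precoder hfading hpilots hM t
  have hest' : ∀ ω, s.estimateGain P h N l k t ω = s.c l k *
      (star (fun m => s.columns h N l ω (s.pilot k, m)) ⬝ᵥ w (s.columns h N l ω)) := by
    intro ω
    rw [estimateGain, hwe]
    rfl
  have hest'' : ∀ ω, (s.c l k : ℂ) * (star (fun m => s.columns h N l ω (s.pilot k, m)) ⬝ᵥ
      s.precoder P h N l t ω) = s.estimateGain P h N l k t ω := fun _ => rfl
  have hA : Measurable fun x : Fin τ × Fin M → ℂ =>
      (s.c l k : ℂ) * (star (fun m => x (s.pilot k, m)) ⬝ᵥ w x) := by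
    refine Measurable.const_mul (Finset.measurable_sum _ fun m _ => Measurable.mul ?_ ?_) _
    · exact Complex.continuous_conj.measurable.comp (measurable_pi_apply (s.pilot k, m))
    · fun_prop
  -- The estimated part is the affine term and the error the Gaussian vector. The incoherent
  -- contributions `(1 - δ * δ) * γ` and `β - γ` add up to `β - δ * δ * γ`.
  have h1 := moments_add_dotProduct_gaussianVector (hasLaw_estimationError hfading hpilots l k)
    (hasLaw_columns hfading hpilots l k).aemeasurable
    (indepFun_columns_estimationError hfading hpilots l k) hA hw
    (by simpa only [← hest'] using hest.1) (by simpa only [← hwe] using hnorm.1)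
  simp only [← hwe, hest''] at h1
  simp only [← gain_eq, hest.2.1, hest.2.2, hnorm.2, coe_errorVariance] at h1
  refine ⟨h1.1, h1.2.1, ?_⟩
  rw [h1.2.2]
  ring

/-- Each gain is a measurable function of the channels and the noise of its own AP, because the
precoder is local. -/
lemma indepFun_gain (hfading : s.RayleighFading P h N) (hpilots : s.OrthogonalPilots)
    {l l' : Fin L} (hl : l ≠ l') (k t : Fin K) :
    IndepFun (s.gain P h N l k t) (s.gain P h N l' k t) P := by
  have hG : ∀ l, ∃ G : ((Fin K ⊕ Fin τ) × Fin M → ℂ) → ℂ, Measurable G ∧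
      s.gain P h N l k t = G ∘ source h N l := by
    intro l
    obtain ⟨w, hw, hwe⟩ := exists_measurable_precoder s P h N l t
    refine ⟨fun x => star (fun m => x (Sum.inl k, m)) ⬝ᵥ
      w fun z => ∑ y, s.columnCoeff z.1 y * x (y, z.2), ?_, ?_⟩
    · refine Finset.measurable_sum _ fun m _ => Measurable.mul ?_ ?_
      · exact Complex.continuous_conj.measurable.comp (measurable_pi_apply (Sum.inl k, m))
      · have h1 : Measurable fun x : (Fin K ⊕ Fin τ) × Fin M → ℂ =>
          w fun z => ∑ y, s.columnCoeff z.1 y * x (y, z.2) := hw.comp (by fun_prop)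
        fun_prop
    · ext ω
      have h2 : s.columns h N l ω =
          fun z => ∑ y, s.columnCoeff z.1 y * source h N l ω (y, z.2) := by
        ext z
        exact Hbar_apply hpilots l ω z.2 z.1
      rw [gain, hwe, h2]
      rfl
  obtain ⟨G, hGm, hGe⟩ := hG l
  obtain ⟨G', hGm', hGe'⟩ := hG l'
  rw [hGe, hGe']
  exact (indepFun_source hfading hl).comp hGm hGm'

end System

/-! ### Superposition of the APs. -/

section SumOfIndependent

variable {Ω : Type*} [MeasurableSpace Ω] {P : Measure Ω} [IsProbabilityMeasure P] {ι : Type*}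
  [Fintype ι] {X : ι → Ω → ℂ}

lemma integral_norm_sq_sum_sub_mean_of_indepFun (hX : ∀ i, MemLp (X i) 2 P)
    (hind : ∀ i j, i ≠ j → IndepFun (X i) (X j) P) :
    ∫ ω, ‖∑ i, (X i ω - ∫ ω', X i ω' ∂P)‖ ^ 2 ∂P =
      ∑ i, (∫ ω, ‖X i ω‖ ^ 2 ∂P - ‖∫ ω, X i ω ∂P‖ ^ 2) := by
  rw [integral_norm_sq_sum_of_orthogonal (X := fun i ω => X i ω - ∫ ω', X i ω' ∂P)
    (fun i => (hX i).sub (memLp_const _))]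
  · exact Finset.sum_congr rfl fun i _ => integral_norm_sq_sub_mean (hX i)
  · intro i j hij
    rw [(hind i j hij).integral_fun_comp_mul_comp (f := fun z => z - ∫ ω', X i ω' ∂P)
      (g := fun z => conj (z - ∫ ω', X j ω' ∂P)) (hX i).1.aemeasurable (hX j).1.aemeasurable
      (by fun_prop) (by fun_prop), integral_sub ((hX i).integrable one_le_two)
      (integrable_const _)]
    simp

/-- A second moment is the squared modulus of the mean plus the variance, and variances of pairwise
independent variables add. The first term becomes the coherent interference, the second the
incoherent one. -/
lemma integral_norm_sq_sum_of_indepFun (hX : ∀ i, MemLp (X i) 2 P)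
    (hind : ∀ i j, i ≠ j → IndepFun (X i) (X j) P) :
    ∫ ω, ‖∑ i, X i ω‖ ^ 2 ∂P = ‖∑ i, ∫ ω, X i ω ∂P‖ ^ 2 +
      ∑ i, (∫ ω, ‖X i ω‖ ^ 2 ∂P - ‖∫ ω, X i ω ∂P‖ ^ 2) := by
  have hsum : MemLp (fun ω => ∑ i, X i ω) 2 P := memLp_finsetSum _ fun i _ => hX i
  have h1 := integral_norm_sq_sub_mean hsum
  rw [integral_finsetSum _ fun i _ => (hX i).integrable one_le_two] at h1
  simp_rw [← Finset.sum_sub_distrib] at h1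
  rw [integral_norm_sq_sum_sub_mean_of_indepFun hX hind] at h1
  rw [h1]
  ring

end SumOfIndependent

/-! ### The SINR in closed form. -/

namespace System

variable {L K τ M : ℕ} {s : System L K τ} {Ω : Type*} [MeasurableSpace Ω] {P : Measure Ω}
  {h : Fin L → Fin K → Ω → Fin M → ℂ} {N : Fin L → Ω → Matrix (Fin M) (Fin τ) ℂ}

lemma integral_norm_sq_estimate (hfading : s.RayleighFading P h N)
    (hpilots : s.OrthogonalPilots) (l : Fin L) (k : Fin K) (m : Fin M) :
    ∫ ω, ‖s.estimate h N l k ω m‖ ^ 2 ∂P = s.γ l k := by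
  have h1 : ∀ ω, ‖s.estimate h N l k ω m‖ ^ 2 =
      s.c l k ^ 2 * ‖(s.Hbar h N l ω).col (s.pilot k) m‖ ^ 2 := by
    intro ω
    rw [estimate, Pi.smul_apply, smul_eq_mul, norm_mul, mul_pow, Complex.norm_real,
      Real.norm_eq_abs, sq_abs]
    rfl
  have h2 := integral_norm_pow_gaussianVector (hasLaw_column hfading hpilots l k) m 1
  simp only [mul_one, pow_one, Nat.factorial_one, Nat.cast_one] at h2
  simp_rw [h1]
  rw [integral_const_mul, h2, c_sq_mul_columnVariance]

lemma precoder_apply (l : Fin L) (t : Fin K) (ω : Ω) : s.precoder P h N l t ω =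
    if t ∈ s.strong l then s.zf P h N l t ω else s.mrt P h N l t ω := by
  rw [precoder]
  split_ifs <;> rfl

lemma totalGain_eq (k t : Fin K) (ω : Ω) : s.totalGain P h N k t ω = s.UI P h N k t ω := by
  rw [totalGain, UI, Finset.sum_filter, Finset.sum_filter, ← Finset.sum_add_distrib]
  refine Finset.sum_congr rfl fun l _ => ?_
  rw [gain, precoder_apply]
  by_cases ht : t ∈ s.strong l <;> simp [ht]

lemma meanGain_eq (k : Fin K) : s.meanGain P h N k = s.CP P h N k := by
  rw [meanGain, CP, Finset.sum_filter, Finset.sum_filter, ← Finset.sum_add_distrib]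
  refine Finset.sum_congr rfl fun l _ => ?_
  simp only [gain, precoder_apply]
  by_cases hk : k ∈ s.strong l <;> simp [hk]

/-- The amplitude with which the symbol of a copilot UE is received coherently. -/
def coherentAmplitude (s : System L K τ) (M : ℕ) (k t : Fin K) : ℝ :=
  ∑ l, √(((M : ℝ) - s.δ l t * s.tauS l) * s.ρ l t * s.γ l k)

/-- The power of the incoherent part of the received symbol of a UE. -/
def incoherentPower (s : System L K τ) (k t : Fin K) : ℝ :=
  ∑ l, (s.ρ l t : ℝ) * ((s.β l k : ℝ) - s.δ l t * s.δ l k * s.γ l k)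

lemma sum_sqrt_mul_gainMean (M : ℕ) (k t : Fin K) :
    ∑ l, √(s.ρ l t : ℝ) * s.gainMean M l k t =
      if s.pilot t = s.pilot k then s.coherentAmplitude M k t else 0 := by
  unfold gainMean coherentAmplitude
  split_ifs
  · refine Finset.sum_congr rfl fun l _ => ?_
    rw [← Real.sqrt_mul (NNReal.coe_nonneg _)]
    ring_nf
  · simp

lemma indepFun_scaled_gain (hfading : s.RayleighFading P h N) (hpilots : s.OrthogonalPilots)
    (k t : Fin K) (l l' : Fin L) (hl : l ≠ l') :
    IndepFun (fun ω => ((√(s.ρ l t : ℝ) : ℝ) : ℂ) * s.gain P h N l k t ω)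
      (fun ω => ((√(s.ρ l' t : ℝ) : ℝ) : ℂ) * s.gain P h N l' k t ω) P :=
  (indepFun_gain hfading hpilots hl k t).comp
    (φ := fun z => ((√(s.ρ l t : ℝ) : ℝ) : ℂ) * z) (ψ := fun z => ((√(s.ρ l' t : ℝ) : ℝ) : ℂ) * z)
    (by fun_prop) (by fun_prop)

lemma closedFormSINR_eq (M : ℕ) (k : Fin K) :
    s.closedFormSINR M k = s.coherentAmplitude M k k ^ 2 /
      (∑ t ∈ Finset.univ.erase k,
          (if s.pilot t = s.pilot k then s.coherentAmplitude M k t ^ 2 else 0)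
        + ∑ t, s.incoherentPower k t + 1) := by
  have h1 : s.coPilot k \ {k} = (Finset.univ.erase k).filter fun t => s.pilot t = s.pilot k := by
    ext t
    simp [coPilot, and_comm]
  rw [closedFormSINR, h1, Finset.sum_filter]
  rfl

variable [IsProbabilityMeasure P]

lemma moments_scaled_gain (hfading : s.RayleighFading P h N) (hpilots : s.OrthogonalPilots)
    (hgroup : s.CoPilotGrouping) (hM : ∀ l, s.tauS l < M) (k t : Fin K) (l : Fin L) :
    MemLp (fun ω => ((√(s.ρ l t : ℝ) : ℝ) : ℂ) * s.gain P h N l k t ω) 2 P ∧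
    ∫ ω, ((√(s.ρ l t : ℝ) : ℝ) : ℂ) * s.gain P h N l k t ω ∂P =
      ((√(s.ρ l t : ℝ) * s.gainMean M l k t : ℝ) : ℂ) ∧
    ∫ ω, ‖((√(s.ρ l t : ℝ) : ℝ) : ℂ) * s.gain P h N l k t ω‖ ^ 2 ∂P -
      ‖∫ ω, ((√(s.ρ l t : ℝ) : ℝ) : ℂ) * s.gain P h N l k t ω ∂P‖ ^ 2 =
      (s.ρ l t : ℝ) * ((s.β l k : ℝ) - s.δ l t * s.δ l k * s.γ l k) := by
  obtain ⟨h1, h2, h3⟩ := moments_gain hfading hpilots hgroup (hM l) k t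
  have h4 : ∫ ω, ((√(s.ρ l t : ℝ) : ℝ) : ℂ) * s.gain P h N l k t ω ∂P =
      ((√(s.ρ l t : ℝ) * s.gainMean M l k t : ℝ) : ℂ) := by
    rw [integral_const_mul, h2, Complex.ofReal_mul]
  refine ⟨h1.const_mul _, h4, ?_⟩
  rw [h4]
  simp only [norm_mul, mul_pow, Complex.norm_real, Real.norm_eq_abs, sq_abs,
    Real.sq_sqrt (NNReal.coe_nonneg _)]
  rw [integral_const_mul, h3]
  ring

lemma CP_eq (hfading : s.RayleighFading P h N) (hpilots : s.OrthogonalPilots)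
    (hgroup : s.CoPilotGrouping) (hM : ∀ l, s.tauS l < M) (k : Fin K) :
    s.CP P h N k = (s.coherentAmplitude M k k : ℂ) := by
  have h1 := sum_sqrt_mul_gainMean (s := s) M k k
  rw [if_pos rfl] at h1
  rw [CP, ← h1, Complex.ofReal_sum]
  refine Finset.sum_congr rfl fun l _ => ?_
  rw [← integral_const_mul]
  exact (moments_scaled_gain hfading hpilots hgroup hM k k l).2.1

lemma integral_norm_sq_UI (hfading : s.RayleighFading P h N) (hpilots : s.OrthogonalPilots)
    (hgroup : s.CoPilotGrouping) (hM : ∀ l, s.tauS l < M) (k t : Fin K) :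
    ∫ ω, ‖s.UI P h N k t ω‖ ^ 2 ∂P =
      (if s.pilot t = s.pilot k then s.coherentAmplitude M k t ^ 2 else 0) +
        s.incoherentPower k t := by
  have hmom := moments_scaled_gain hfading hpilots hgroup hM k t
  simp only [UI]
  rw [integral_norm_sq_sum_of_indepFun (fun l => (hmom l).1)
    (indepFun_scaled_gain hfading hpilots k t), incoherentPower]
  congr 1
  · simp_rw [(hmom _).2.1]
    rw [← Complex.ofReal_sum, sum_sqrt_mul_gainMean, Complex.norm_real, Real.norm_eq_abs, sq_abs]
    split_ifs <;> simp
  · exact Finset.sum_congr rfl fun l _ => (hmom l).2.2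

lemma integral_norm_sq_PU (hfading : s.RayleighFading P h N) (hpilots : s.OrthogonalPilots)
    (hgroup : s.CoPilotGrouping) (hM : ∀ l, s.tauS l < M) (k : Fin K) :
    ∫ ω, ‖s.PU P h N k ω‖ ^ 2 ∂P = s.incoherentPower k k := by
  have hmom := moments_scaled_gain hfading hpilots hgroup hM k k
  simp only [PU, ← integral_const_mul]
  rw [integral_norm_sq_sum_sub_mean_of_indepFun (fun l => (hmom l).1)
    (indepFun_scaled_gain hfading hpilots k k), incoherentPower]
  exact Finset.sum_congr rfl fun l _ => (hmom l).2.2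

lemma effectiveSINR_eq (hfading : s.RayleighFading P h N) (hpilots : s.OrthogonalPilots)
    (hgroup : s.CoPilotGrouping) (hM : ∀ l, s.tauS l < M) (k : Fin K) :
    s.effectiveSINR P h N k = s.closedFormSINR M k := by
  rw [effectiveSINR, closedFormSINR_eq, CP_eq hfading hpilots hgroup hM,
    integral_norm_sq_PU hfading hpilots hgroup hM, Complex.norm_real, Real.norm_eq_abs, sq_abs]
  simp_rw [integral_norm_sq_UI hfading hpilots hgroup hM]
  -- The gain uncertainty supplies the summand `t = k` that the sum over interferers lacks.
  rw [Finset.sum_add_distrib, ← Finset.add_sum_erase _ (s.incoherentPower k) (Finset.mem_univ k)]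
  congr 2
  ring

lemma pzfSINR_eq (hfading : s.RayleighFading P h N) (hpilots : s.OrthogonalPilots)
    (hgroup : s.CoPilotGrouping) (hM : ∀ l, s.tauS l < M) (k : Fin K) :
    s.pzfSINR P h N k = s.closedFormSINR M k := by
  rw [pzfSINR, closedFormSINR_eq, meanGain_eq, CP_eq hfading hpilots hgroup hM, Complex.norm_real,
    Real.norm_eq_abs, sq_abs]
  simp_rw [totalGain_eq, integral_norm_sq_UI hfading hpilots hgroup hM]
  -- The coherent summand `t = k` is the squared mean gain and cancels against the subtracted one.
  rw [Finset.sum_add_distrib, ← Finset.add_sum_erase _ (fun t =>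
    if s.pilot t = s.pilot k then s.coherentAmplitude M k t ^ 2 else 0) (Finset.mem_univ k),
    if_pos rfl]
  congr 2
  ring

end System

end CellFree

end

theorem corollary2 {L K M τ : ℕ} (s : CellFree.System L K τ)
    {Ω : Type*} [MeasurableSpace Ω] (P : MeasureTheory.Measure Ω)
    [MeasureTheory.IsProbabilityMeasure P]
    (h : Fin L → Fin K → Ω → Fin M → ℂ) (N : Fin L → Ω → Matrix (Fin M) (Fin τ) ℂ)
    (hfading : s.RayleighFading P h N)
    (hpilots : s.OrthogonalPilots)
    (hgroup : s.CoPilotGrouping)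
    (hM : ∀ l, s.tauS l < M)
    (k : Fin K) :
    -- the coefficient `γ` is the mean square of each entry of the channel estimate
    (∀ l m, ∫ ω, ‖s.estimate h N l k ω m‖ ^ 2 ∂P = s.γ l k) ∧
    -- the precoders are well defined and of unit mean square norm
    (∀ l t, ∫ ω, CellFree.vecNormSq (s.precoder P h N l t ω) ∂P = 1) ∧
    -- the effective channels are square integrable, so that all expectations below exist
    (∀ l t, MeasureTheory.MemLp (s.gain P h N l k t) 2 P) ∧
    -- the effective SINR has the closed form, and the spectral efficiency with it
    s.effectiveSINR P h N k = s.closedFormSINR M k ∧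
    s.pzfSINR P h N k = s.closedFormSINR M k ∧
    ∀ (ξ : ℝ) (τc : ℕ), 0 < ξ → ξ < 1 → τ ≤ τc →
      CellFree.spectralEfficiency ξ τ τc (s.effectiveSINR P h N k) =
        CellFree.spectralEfficiency ξ τ τc (s.closedFormSINR M k) := by
  have hsinr := CellFree.System.effectiveSINR_eq hfading hpilots hgroup hM k
  exact ⟨fun l m => CellFree.System.integral_norm_sq_estimate hfading hpilots l k m,
    fun l t => (CellFree.System.moments_precoder hfading hpilots (hM l) t).2,
    fun l t => (CellFree.System.moments_gain hfading hpilots hgroup (hM l) k t).1, hsinr,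
    CellFree.System.pzfSINR_eq hfading hpilots hgroup hM k,
    fun ξ τc _ _ _ => congrArg (CellFree.spectralEfficiency ξ τ τc) hsinr⟩
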